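/- **Setting.** Let $S=\{x_1,\dots,x_g\}$ be a finite set, $\bar S=\{\bar x_1,\dots,\bar x_g\}$, let $F(S)$ be the free group on $S$, with $\bar w$ the inverse of $w$ (so $\bar{\bar y}=y$ for $y\in S\cup\bar S$). A rack is a set with operations $x^y=x\rhd y$ and $x^{\bar y}=x\rhd^{-1}y$ such that $(x^y)^{\bar y}=(x^{\bar y})^y=x$ and $(x\rhd y)\rhd z=(x\rhd z)\rhd(y\rhd z)$. The free rack is $FR(S)=\{a^u\mid a\in S,\ u\in F(S)\}$ with $a^u\rhd^{\pm1}b^v=a^{u\bar v b^{\pm1}v}$. Let $R$ be a finite set of primary relations $x_i^{u}=x_j$ with $u\in F(S)$ a reduced word. We assume that $R$ contains no relation $x_i=x_j$ with empty word $u$ and $i\ne j$. Then $\mathcal R=\langle S\mid R\rangle$ is the quotient of $FR(S)$ by the smallest congruence containing $R$. Let $R_2$ be the set of reduced forms of the words $\bar u x_i u\bar x_j$, for $x_i^u=x_j$ in $R$. **Tables.** An enumeration table is $\mathcal E=(\omega,A,\tau,\rho)$, where $A$ is a partial function $\{1,\dots,\omega\}\times(S\cup\bar S)\to\{1,\dots,\omega\}$,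 written $i^y=A(i,y)$, $\tau:\{1,\dots,\omega\}\to\mathcal R$, and $\rho:\{1,\dots,\omega\}\to\{1,\dots,\omega\}$ with $\rho(i)\le i$. Its live elements are $\Omega=\{i\mid\rho(i)=i\}$; it is complete if $i^y$ is defined for all $i\in\Omega$ and $y\in S\cup\bar S$. Put $\max\emptyset=0$. **Subroutines.** - $\mathrm{Rep}(i)$: starting at $j=i$, replace $j$ by $\rho(j)$ while $\rho(j)<j$; return $j$. $\mathrm{Update}(i)$: set $\rho(n):=\mathrm{Rep}(i)$ for all $n$ in the orbit of $i$ under $\rho$. - $\mathrm{Define}(i,y)$: $\omega:=\omega+1$, then $i^y:=\omega$, $\omega^{\bar y}:=i$, $\tau(\omega):=\tau(i)^y$, $\rho(\omega):=\omega$. $\mathrm{Deduction}(i,y,j)$: $i^y:=j$, $j^{\bar y}:=i$. - $\mathrm{Merge}(m,n)$, for a queue $Q$: let $\mu=\mathrm{Rep}(m)$, $\nu=\mathrm{Rep}(n)$; if $\mu\ne\nu$, append $\max(\mu,\nu)$ to $Q$ and set $\rho(\max(\mu,\nu)):=\min(\mu,\nu)$. - $\mathrm{Coincidence}(m,n)$: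 start with $Q$ empty and call $\mathrm{Merge}(m,n)$. Then, for the successive elements $d$ of $Q$ until $Q$ is exhausted, and for each $x\in S\cup\bar S$ for which $d^x=e$ is defined: undefine $d^x$ and $e^{\bar x}$; let $\delta=\mathrm{Rep}(d)$ and call $\mathrm{Update}(d)$; let $\epsilon=\mathrm{Rep}(e)$ and call $\mathrm{Update}(e)$; if $\delta^x$ is defined, call $\mathrm{Merge}(\epsilon,\delta^x)$; otherwise, if $\epsilon^{\bar x}$ is defined, call $\mathrm{Merge}(\delta,\epsilon^{\bar x})$; otherwise set $\delta^x:=\epsilon$, $\epsilon^{\bar x}:=\delta$. - $\mathrm{Scan}(i,y_1\cdots y_t,j)$: start with $f=1$, $b=t$, $k=i$, $\ell=j$. While $f\le b$: (1) while $f\le b$ and $k^{y_f}$ is defined, $k:=k^{y_f}$, $f:=f+1$; (2) while $f\le b$ and $\ell^{\bar y_b}$ is defined, $\ell:=\ell^{\bar y_b}$, $b:=b-1$; (3) if $f<b$, call $\mathrm{Define}(k,y_f)$; if $f=b$, call $\mathrm{Deduction}(k,y_f,\ell)$ and stop; if $f>b$ and $k\ne\ell$, call $\mathrm{Coincidence}(k,\ell)$;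 if $f>b$ and $k=\ell$, stop. **Procedure** $\mathrm{Enumerate}(S,R,M)$. Initialize $\omega=g$, $A$ nowhere defined, $\tau(i)=x_i$, $\rho(i)=i$ for $1\le i\le g$. For each $x_i^u=x_j$ in $R$ call $\mathrm{Scan}(\mathrm{Rep}(i),u,\mathrm{Rep}(j))$. Put $i:=1$. While $i\le\max(\Omega)$ and $i\le M$: for each $w\in R_2$ call $\mathrm{Scan}(i,w,i)$, breaking off as soon as $i\notin\Omega$; then, if $i\in\Omega$, call $\mathrm{Define}(i,y)$ for every $y\in S\cup\bar S$ with $i^y$ undefined; then $i:=i+1$. Finally, if $i>\max(\Omega)$, return the table $\mathcal E$; otherwise return "run limit exceeded". The procedure *completes* if it returns a table and this table is complete. The loops over $R$, $R_2$ and $S\cup\bar S$ run in arbitrary orders, fixed in advance independently of $M$. **Theorem.** If the rack $\mathcal R=\langle S\mid R\rangle$ is finite, then, whatever the chosen loop orders, there is a run limit $M$ for which $\mathrm{Enumerate}(S,R,M)$ completes. -/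

import Mathlib

open scoped Quandles

noncomputable section

namespace RackEnum

/-! ### Free racks, congruences and rack presentations

Mathlib racks act from the left: `y ◃ x` is the element written `x ▷ y` or `x ^ y` in the
right-handed exponential notation, and `y ◃⁻¹ x` is `x ▷⁻¹ y`. -/

/-- The free rack on `S`: the pair `(a, u)` is the element `a ^ u` with `a ∈ S` and `u ∈ F(S)`. -/
@[ext]
structure FreeRack (S : Type) where
  gen : S
  exp : FreeGroup S

/-- `a ^ u ▷ b ^ v = a ^ (u v⁻¹ b v)` and `a ^ u ▷⁻¹ b ^ v = a ^ (u v⁻¹ b⁻¹ v)`. -/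
instance (S : Type) : Rack (FreeRack S) where
  act y x := ⟨x.gen, x.exp * y.exp⁻¹ * FreeGroup.of y.gen * y.exp⟩
  invAct y x := ⟨x.gen, x.exp * y.exp⁻¹ * (FreeGroup.of y.gen)⁻¹ * y.exp⟩
  self_distrib := by
    intro x y z
    simp [mul_assoc]
  left_inv := by
    intro y x
    simp [mul_assoc]
  right_inv := by
    intro y x
    simp [mul_assoc]

/-- The smallest congruence on a rack that contains a given set `P` of pairs. -/
inductive CongruenceClosure {X : Type} [Rack X] (P : Set (X × X)) : X → X → Prop
  | of {x y : X} : (x, y) ∈ P → CongruenceClosure P x y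
  | refl (x : X) : CongruenceClosure P x x
  | symm {x y : X} : CongruenceClosure P x y → CongruenceClosure P y x
  | trans {x y z : X} :
      CongruenceClosure P x y → CongruenceClosure P y z → CongruenceClosure P x z
  | act {x x' y y' : X} : CongruenceClosure P x x' → CongruenceClosure P y y' →
      CongruenceClosure P (y ◃ x) (y' ◃ x')
  | invAct {x x' y y' : X} : CongruenceClosure P x x' → CongruenceClosure P y y' →
      CongruenceClosure P (y ◃⁻¹ x) (y' ◃⁻¹ x')

/-- The smallest congruence as a setoid. -/
def congruenceSetoid {X : Type} [Rack X] (P : Set (X × X)) : Setoid X where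
  r := CongruenceClosure P
  iseqv := ⟨CongruenceClosure.refl, CongruenceClosure.symm, CongruenceClosure.trans⟩

/-- A relation `x_src ^ word = x_tgt` on the generators `x_1, …, x_g` (indexed by `Fin g`). -/
structure Relation (g : ℕ) where
  src : Fin g
  word : FreeGroup (Fin g)
  tgt : Fin g

/-- The pairs `(x_i ^ u, x_j)` in `FR(S) × FR(S)` given by a set of relations. -/
def relationPairs {g : ℕ} (R : Finset (Relation g)) :
    Set (FreeRack (Fin g) × FreeRack (Fin g)) :=
  {p | ∃ r ∈ R, p = (⟨r.src, r.word⟩, ⟨r.tgt, 1⟩)}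

/-- The rack `⟨S | R⟩` with `S = {x_1, …, x_g}`: the quotient of the free rack by the smallest
congruence that contains `R`. -/
def PresentedRack {g : ℕ} (R : Finset (Relation g)) : Type :=
  Quotient (congruenceSetoid (relationPairs R))

instance {g : ℕ} (R : Finset (Relation g)) : Rack (PresentedRack R) where
  act := Quotient.map₂ (fun y x => y ◃ x) fun _ _ hy _ _ hx => CongruenceClosure.act hx hy
  invAct := Quotient.map₂ (fun y x => y ◃⁻¹ x) fun _ _ hy _ _ hx => CongruenceClosure.invAct hx hy
  self_distrib := by
    rintro ⟨x⟩ ⟨y⟩ ⟨z⟩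
    exact congrArg (Quotient.mk _) (Shelf.self_distrib (x := x) (y := y) (z := z))
  left_inv := by
    rintro ⟨y⟩ ⟨x⟩
    exact congrArg (Quotient.mk _) (Rack.left_inv y x)
  right_inv := by
    rintro ⟨y⟩ ⟨x⟩
    exact congrArg (Quotient.mk _) (Rack.right_inv y x)

/-- The generator `x_i` of `⟨S | R⟩`. -/
def PresentedRack.of {g : ℕ} (R : Finset (Relation g)) (i : Fin g) : PresentedRack R :=
  Quotient.mk _ ⟨i, 1⟩

/-! ### Letters, words and secondary relations -/

/-- An element of `S ∪ S̄`: `(i, true)` is `x_i` and `(i, false)` is `x̄_i`, as in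
`FreeGroup.toWord`. -/
abbrev Letter (g : ℕ) : Type := Fin g × Bool

/-- `y ↦ ȳ` on `S ∪ S̄`. -/
def Letter.bar {g : ℕ} (y : Letter g) : Letter g := (y.1, !y.2)

/-- `p ^ y` for an element `p` of `⟨S | R⟩` and `y ∈ S ∪ S̄`. -/
def PresentedRack.pow {g : ℕ} {R : Finset (Relation g)} (p : PresentedRack R) (y : Letter g) :
    PresentedRack R :=
  if y.2 then PresentedRack.of R y.1 ◃ p else PresentedRack.of R y.1 ◃⁻¹ p

/-- The reduced form of the word `ū x_i u x̄_j` of the secondary relation of `x_i ^ u = x_j`. -/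
def Relation.secondary {g : ℕ} (r : Relation g) : List (Letter g) :=
  (r.word⁻¹ * FreeGroup.of r.src * r.word * (FreeGroup.of r.tgt)⁻¹).toWord

/-! ### Enumeration tables -/

/-- An enumeration table `(ω, A, τ, ρ)`. The rows are `1, …, ω`; `A i y = some j` means that
`i ^ y` is defined and equal to `j`, and `A i y = none` that it is undefined. The procedures
below only ever store data for the rows `1, …, ω`. -/
structure Table {g : ℕ} (R : Finset (Relation g)) where
  ω : ℕ
  A : ℕ → Letter g → Option ℕ
  τ : ℕ → Option (PresentedRack R)
  ρ : ℕ → ℕ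

section Procedures

variable {g : ℕ} {R : Finset (Relation g)}

/-- The set `Ω` of live elements. -/
def Table.live (T : Table R) : Finset ℕ := (Finset.Icc 1 T.ω).filter fun i => T.ρ i = i

/-- Every entry of every live row is defined. -/
def Table.IsComplete (T : Table R) : Prop :=
  ∀ i ∈ T.live, ∀ y : Letter g, (T.A i y).isSome

/-- Overwrite the single entry `i ^ y`. -/
def Table.setEntry (T : Table R) (i : ℕ) (y : Letter g) (v : Option ℕ) : Table R :=
  { T with A := fun j z => if j = i ∧ z = y then v else T.A j z }

/-- `i ^ y := j` and `j ^ ȳ := i`. This is the procedure `Deduction`. -/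
def Table.deduction (T : Table R) (i : ℕ) (y : Letter g) (j : ℕ) : Table R :=
  (T.setEntry i y (some j)).setEntry j y.bar (some i)

/-- The procedure `Define`: a new row `ω + 1` is added, with `i ^ y = ω + 1`. -/
def Table.define (T : Table R) (i : ℕ) (y : Letter g) : Table R :=
  let n := T.ω + 1
  Table.deduction
    { ω := n
      A := T.A
      τ := Function.update T.τ n ((T.τ i).map fun p => p.pow y)
      ρ := Function.update T.ρ n n } i y n

/-- The table produced by `Init`: row `i` stands for the generator `x_i`, `1 ≤ i ≤ g`. -/
def Table.init (R : Finset (Relation g)) : Table R where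
  ω := g
  A := fun _ _ => none
  τ := fun i => if h : 1 ≤ i ∧ i ≤ g then some (PresentedRack.of R ⟨i - 1, by omega⟩) else none
  ρ := fun i => i

/-- The procedure `Rep`: replace `j` by `ρ j` as long as `ρ j < j`. -/
def rep (ρ : ℕ → ℕ) (j : ℕ) : ℕ := if ρ j < j then rep ρ (ρ j) else j
termination_by j

/-- The loop of `Update`: set `ρ n := ε` along the orbit that starts at `n`. -/
def updateLoop (ε : ℕ) (ρ : ℕ → ℕ) (n : ℕ) : ℕ → ℕ :=
  if ρ n < n then updateLoop ε (Function.update ρ n ε) (ρ n) else ρ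
termination_by n

/-- The procedure `Update`. -/
def Table.update (T : Table R) (i : ℕ) : Table R :=
  { T with ρ := updateLoop (rep T.ρ i) T.ρ i }

/-- The procedure `Merge`, acting on a table together with a queue. -/
def merge (s : Table R × List ℕ) (m n : ℕ) : Table R × List ℕ :=
  let μ := rep s.1.ρ m
  let ν := rep s.1.ρ n
  if μ ≠ ν then
    ({ s.1 with ρ := Function.update s.1.ρ (max μ ν) (min μ ν) }, s.2 ++ [max μ ν])
  else s

/-- The body of the `for` loop of `Coincidence` for the queue element `d` and `x ∈ S ∪ S̄`. -/
def coincidenceStep (d : ℕ) (s : Table R × List ℕ) (x : Letter g) : Table R × List ℕ :=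
  match s.1.A d x with
  | none => s
  | some e =>
    let T₀ := (s.1.setEntry d x none).setEntry e x.bar none
    let δ := rep T₀.ρ d
    let T₁ := T₀.update d
    let ε := rep T₁.ρ e
    let T₂ := T₁.update e
    match T₂.A δ x with
    | some f => merge (T₂, s.2) ε f
    | none =>
      match T₂.A ε x.bar with
      | some f => merge (T₂, s.2) δ f
      | none => (T₂.deduction δ x ε, s.2)

/-- The `while` loop of `Coincidence`, run on the part of the queue that is still to be processed.
`PFun.fix` repeats a step for as long as it yields `Sum.inr`, has no value if this never ends, and
`order` is the order in which the `for` loop runs through `S ∪ S̄`. -/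
def coincidenceLoop (order : List (Letter g)) : Table R × List ℕ →. Table R :=
  PFun.fix fun s =>
    match s.2 with
    | [] => Part.some (Sum.inl s.1)
    | d :: Q => Part.some (Sum.inr (order.foldl (coincidenceStep d) (s.1, Q)))

/-- The procedure `Coincidence`. -/
def coincidence (order : List (Letter g)) (T : Table R) (m n : ℕ) : Part (Table R) :=
  coincidenceLoop order (merge (T, []) m n)

/-- Forward scan: `(k, y_f ⋯ y_b)` is replaced by `(k ^ y_f, y_{f+1} ⋯ y_b)` while `k ^ y_f` is
defined. -/
def scanForward (T : Table R) : ℕ → List (Letter g) → ℕ × List (Letter g)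
  | k, [] => (k, [])
  | k, y :: v =>
    match T.A k y with
    | some k' => scanForward T k' v
    | none => (k, y :: v)

/-- Backward scan: `(ℓ, y_f ⋯ y_b)` is replaced by `(ℓ ^ ȳ_b, y_f ⋯ y_{b-1})` while `ℓ ^ ȳ_b` is
defined. This is a forward scan of the word `ȳ_b ⋯ ȳ_f` from `ℓ`. -/
def scanBackward (T : Table R) (l : ℕ) (v : List (Letter g)) : ℕ × List (Letter g) :=
  let p := scanForward T l (v.map Letter.bar).reverse
  (p.1, (p.2.map Letter.bar).reverse)

/-- The outer `while` loop of `Scan`. The state `(T, k, ℓ, v)` holds the table, the current ends of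
the forward and the backward scan, and the unscanned part `v = y_f ⋯ y_b` of the word; so `f ≤ b`,
`f < b`, `f = b` say that `v` has at least one, at least two, exactly one letter. -/
def scanLoop (order : List (Letter g)) : Table R × ℕ × ℕ × List (Letter g) →. Table R :=
  PFun.fix fun s =>
    let T := s.1
    if s.2.2.2 = [] then Part.some (Sum.inl T)
    else
      let forward := scanForward T s.2.1 s.2.2.2
      let backward := scanBackward T s.2.2.1 forward.2
      let k := forward.1
      let l := backward.1
      match backward.2 with
      | y :: z :: v => Part.some (Sum.inr (T.define k y, k, l, y :: z :: v))
      | [y] => Part.some (Sum.inl (T.deduction k y l))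
      | [] =>
        if k ≠ l then (coincidence order T k l).map fun T' => Sum.inr (T', k, l, [])
        else Part.some (Sum.inl T)

/-- The procedure `Scan` for the relation `i ^ w = j`. -/
def scan (order : List (Letter g)) (T : Table R) (i : ℕ) (w : List (Letter g)) (j : ℕ) :
    Part (Table R) :=
  scanLoop order (T, i, j, w)

/-- The orders in which the `for` loops run through `R`, through the set `R₂` of the reduced words
of the secondary relations, and through `S ∪ S̄` (in `Enumerate` and in `Coincidence`). -/
structure LoopOrders (R : Finset (Relation g)) where
  primary : List (Relation g)
  primary_nodup : primary.Nodup
  mem_primary : ∀ r, r ∈ primary ↔ r ∈ R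
  secondary : List (List (Letter g))
  secondary_nodup : secondary.Nodup
  mem_secondary : ∀ w, w ∈ secondary ↔ ∃ r ∈ R, w = r.secondary
  fill : List (Letter g)
  fill_nodup : fill.Nodup
  mem_fill : ∀ y, y ∈ fill
  merge : List (Letter g)
  merge_nodup : merge.Nodup
  mem_merge : ∀ y, y ∈ merge

/-- The first `for` loop of `Enumerate`: scan the primary relations `x_i ^ u = x_j`. -/
def scanPrimary (o : LoopOrders R) (T : Table R) : Part (Table R) :=
  o.primary.foldlM
    (fun T r => scan o.merge T (rep T.ρ (r.src.val + 1)) r.word.toWord (rep T.ρ (r.tgt.val + 1))) T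

/-- Scan the secondary relations `i ^ w = i`; nothing more happens once `i` is dead. -/
def scanSecondary (o : LoopOrders R) (T : Table R) (i : ℕ) : Part (Table R) :=
  o.secondary.foldlM (fun T w => if i ∈ T.live then scan o.merge T i w i else Part.some T) T

/-- If row `i` is live, fill its undefined entries (Ward's modification). -/
def fillRow (o : LoopOrders R) (T : Table R) (i : ℕ) : Table R :=
  if i ∈ T.live then
    o.fill.foldl (fun T y => if (T.A i y).isNone then T.define i y else T) T
  else T

/-- The `while` loop of `Enumerate`, whose final state is the table and the counter `i`. The maximum
of `Ω` is read as `0` if there are no generators. -/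
def enumerateLoop (o : LoopOrders R) (M : ℕ) : Table R × ℕ →. Table R × ℕ :=
  PFun.fix fun s =>
    if s.2 ≤ s.1.live.sup id ∧ s.2 ≤ M then
      (scanSecondary o s.1 s.2).map fun T => Sum.inr (fillRow o T s.2, s.2 + 1)
    else Part.some (Sum.inl s)

/-- The procedure `Enumerate` with run limit `M`: the value `some E` means that the table `E` is
returned, and the value `none` means "run limit exceeded". -/
def enumerate (o : LoopOrders R) (M : ℕ) : Part (Option (Table R)) := do
  let T ← scanPrimary o (Table.init R)
  let s ← enumerateLoop o M (T, 1)
  return if s.1.live.sup id < s.2 then some s.1 else none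

/-- `Enumerate` completes: it returns a table, and this table is complete. -/
def Completes (o : LoopOrders R) (M : ℕ) : Prop :=
  ∃ E : Table R, some E ∈ enumerate o M ∧ E.IsComplete

end Procedures

end RackEnum

end

namespace RackEnum

/-! ### Representatives -/

/-! The subroutines terminate. In `Coincidence`, live rows plus queue length is constant within the
treatment of a queue element and drops by one whenever an element is taken off the queue
(`coincidenceLoop_spec`). In `Scan`, each `Define` lets the next forward scan advance
(`scanLoop_spec`). Both only pass to a larger table or to a quotient: the relation `Table.Le`
carries every path to a path between representatives, so a relation once established persists. Hence
only the main loop could run forever.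

Suppose that it does. The representative of a fixed row never increases, so it stabilises
(`IsRun.exists_rep_limit`). Let X be the set of rows that stay live forever. The counter reaches
each of them, so its entries get filled and its secondary relations get scanned
(`IsRun.row_filled`). The limit entries therefore define a permutation action of F(S) on X. In it,
the limits of the generators satisfy the primary relations, the secondary relations act trivially,
and every point is reached from a generator. Such an X is an image of the presented rack
(`finite_of_perm`), hence finite.

A finite X has all its entries final after some stage. From then on X is closed under the table, and
since every live row is reached from a generator, all live rows lie in X. So the live rows are
bounded while the counter grows, a contradiction (`IsRun.exists_lt`). When the loop stops, each live
row has been processed, so the table is complete (`exists_completes`). -/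

theorem rep_of_fixed {ρ : ℕ → ℕ} {j : ℕ} (h : ρ j = j) : rep ρ j = j := by
  rw [rep, if_neg (by omega)]

theorem rep_apply {ρ : ℕ → ℕ} (hρ : ∀ j, ρ j ≤ j) (j : ℕ) : rep ρ (ρ j) = rep ρ j := by
  rcases (hρ j).lt_or_eq with h | h
  · rw [rep.eq_def ρ j, if_pos h]
  · rw [h]

theorem rep_le (ρ : ℕ → ℕ) (j : ℕ) : rep ρ j ≤ j := by
  induction j using Nat.strong_induction_on with
  | _ j ih =>
    rw [rep]
    split_ifs with h
    · exact (ih _ h).trans h.le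
    · exact le_rfl

theorem apply_rep {ρ : ℕ → ℕ} (hρ : ∀ j, ρ j ≤ j) (j : ℕ) : ρ (rep ρ j) = rep ρ j := by
  induction j using Nat.strong_induction_on with
  | _ j ih =>
    rw [rep]
    split_ifs with h
    · exact ih _ h
    · exact le_antisymm (hρ j) (not_lt.mp h)

theorem rep_rep {ρ : ℕ → ℕ} (hρ : ∀ j, ρ j ≤ j) (j : ℕ) : rep ρ (rep ρ j) = rep ρ j :=
  rep_of_fixed (apply_rep hρ j)

theorem rep_eq_self_iff {ρ : ℕ → ℕ} (hρ : ∀ j, ρ j ≤ j) (j : ℕ) : rep ρ j = j ↔ ρ j = j :=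
  ⟨fun h => h ▸ apply_rep hρ j, rep_of_fixed⟩

theorem update_le {ρ : ℕ → ℕ} (hρ : ∀ j, ρ j ≤ j) {a b : ℕ} (h : b ≤ a) (j : ℕ) :
    Function.update ρ a b j ≤ j := by
  rcases eq_or_ne j a with rfl | hj
  · simpa using h
  · simpa [hj] using hρ j

/-- Shortening a pointer to its representative does not change representatives. -/
theorem rep_update_rep {ρ : ℕ → ℕ} (hρ : ∀ j, ρ j ≤ j) (a j : ℕ) :
    rep (Function.update ρ a (rep ρ a)) j = rep ρ j := by
  induction j using Nat.strong_induction_on with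
  | _ j ih =>
    rcases eq_or_ne j a with rfl | hj
    · rw [rep]
      simp only [Function.update_self]
      split_ifs with h
      · rw [ih _ h, rep_rep hρ]
      · exact le_antisymm (not_lt.mp h) (rep_le ρ j)
    · rw [rep, rep.eq_def ρ j]
      simp only [Function.update_of_ne hj]
      split_ifs with h
      · exact ih _ h
      · rfl

/-- Redirecting the fixed point `a` to the fixed point `b < a` merges the two classes. -/
theorem rep_update_fixed {ρ : ℕ → ℕ} (hρ : ∀ j, ρ j ≤ j) {a b : ℕ} (ha : ρ a = a) (hb : ρ b = b)
    (hab : b < a) (j : ℕ) :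
    rep (Function.update ρ a b) j = if rep ρ j = a then b else rep ρ j := by
  induction j using Nat.strong_induction_on with
  | _ j ih =>
    rcases eq_or_ne j a with rfl | hj
    · rw [rep]
      simp only [Function.update_self]
      rw [if_pos hab, ih _ hab, rep_of_fixed ha, rep_of_fixed hb, if_pos rfl, if_neg hab.ne]
    · rcases (hρ j).lt_or_eq with h | h
      · rw [rep]
        simp only [Function.update_of_ne hj]
        rw [if_pos h, ih _ h, rep_apply hρ]
      · rw [rep_of_fixed h, if_neg hj, rep_of_fixed]
        rw [Function.update_of_ne hj, h]

/-- Path compression is harmless: every step redirects a row to its own representative. The pointer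
function changes during the recursion, so the induction is over all of them; the target remains the
same because representatives do. -/
theorem updateLoop_spec {ρ : ℕ → ℕ} (hρ : ∀ j, ρ j ≤ j) (n : ℕ) :
    (∀ j, updateLoop (rep ρ n) ρ n j ≤ j) ∧
      ∀ j, rep (updateLoop (rep ρ n) ρ n) j = rep ρ j := by
  induction n using Nat.strong_induction_on generalizing ρ with
  | _ n ih =>
    rw [updateLoop]
    split_ifs with h
    · have hle := update_le hρ (rep_le ρ n)
      have key := ih _ h hle
      rw [rep_update_rep hρ, rep_apply hρ] at key
      exact ⟨key.1, fun j => (key.2 j).trans (rep_update_rep hρ n j)⟩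
    · exact ⟨hρ, fun _ => rfl⟩

variable {g : ℕ} {R : Finset (Relation g)}

/-- The representative of a row. -/
abbrev Table.rep (T : Table R) (j : ℕ) : ℕ := RackEnum.rep T.ρ j

theorem Letter.bar_bar (y : Letter g) : y.bar.bar = y := by
  simp [Letter.bar]

theorem Letter.bar_ne (y : Letter g) : y.bar ≠ y := by
  intro h
  have := congrArg Prod.snd h
  simp [Letter.bar] at this

theorem Table.rep_update {T : Table R} (hT : ∀ j, T.ρ j ≤ j) (i j : ℕ) :
    (T.update i).rep j = T.rep j :=
  (updateLoop_spec hT i).2 j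

theorem Table.update_ρ_le {T : Table R} (hT : ∀ j, T.ρ j ≤ j) (i j : ℕ) : (T.update i).ρ j ≤ j :=
  (updateLoop_spec hT i).1 j

theorem Table.deduction_A (T : Table R) (i : ℕ) (y : Letter g) (j k : ℕ) (z : Letter g) :
    (T.deduction i y j).A k z =
      if k = j ∧ z = y.bar then some i else if k = i ∧ z = y then some j else T.A k z := rfl

/-! ### Invariants of tables -/

/-- Invariants of `ω` and `ρ`. -/
structure Table.RowsOK (T : Table R) : Prop where
  ρ_le : ∀ j, T.ρ j ≤ j
  rep_pos : ∀ j, 1 ≤ j → 1 ≤ T.rep j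
  rep_of_lt : ∀ j, T.ω < j → T.rep j = j

/-- The entries `i ^ y = j` and `j ^ ȳ = i` determine each other. -/
def Table.Symm (T : Table R) : Prop :=
  ∀ ⦃r x s⦄, T.A r x = some s → T.A s x.bar = some r

/-- The rows that are their own representatives. -/
def Table.IsLive (T : Table R) (r : ℕ) : Prop := 1 ≤ r ∧ r ≤ T.ω ∧ T.rep r = r

theorem Table.RowsOK.mem_live {T : Table R} (h : T.RowsOK) {r : ℕ} : r ∈ T.live ↔ T.IsLive r := by
  simp [Table.live, Table.IsLive, rep_eq_self_iff h.ρ_le, and_assoc]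

theorem Table.RowsOK.isLive_rep {T : Table R} (h : T.RowsOK) {r : ℕ} (h1 : 1 ≤ r) (h2 : r ≤ T.ω) :
    T.IsLive (T.rep r) :=
  ⟨h.rep_pos r h1, (rep_le _ _).trans h2, rep_rep h.ρ_le r⟩

/-- The edges of `T` embed into those of `T'` up to representatives in `T'`. -/
structure Table.Embeds (T T' : Table R) : Prop where
  rep_rep : ∀ j, T'.rep (T.rep j) = T'.rep j
  edge : ∀ ⦃r x s⦄, T.A r x = some s →
    ∃ r' s', T'.A r' x = some s' ∧ T'.rep r' = T'.rep r ∧ T'.rep s' = T'.rep s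

theorem Table.RowsOK.embeds_refl {T : Table R} (h : T.RowsOK) : T.Embeds T :=
  ⟨RackEnum.rep_rep h.ρ_le, fun _ _ _ he => ⟨_, _, he, rfl, rfl⟩⟩

theorem Table.Embeds.trans {T T' T'' : Table R} (h : T.Embeds T') (h' : T'.Embeds T'') :
    T.Embeds T'' where
  rep_rep j := by rw [← h'.rep_rep, h.rep_rep, h'.rep_rep]
  edge r x s he := by
    obtain ⟨r', s', he', hr, hs⟩ := h.edge he
    obtain ⟨r'', s'', he'', hr', hs'⟩ := h'.edge he'
    refine ⟨r'', s'', he'', ?_, ?_⟩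
    · rw [hr', ← h'.rep_rep r', hr, h'.rep_rep]
    · rw [hs', ← h'.rep_rep s', hs, h'.rep_rep]

/-! ### Merging -/

/-- A proper merge kills exactly one live row and queues exactly that row. This gives the last
clause, the conserved quantity behind the termination of `Coincidence`. -/
theorem merge_spec {T : Table R} (hT : T.RowsOK) (Q : List ℕ) {m n : ℕ}
    (hm : 1 ≤ m ∧ m ≤ T.ω) (hn : 1 ≤ n ∧ n ≤ T.ω) :
    ∃ T' Q', merge (T, Q) m n = (T', Q') ∧ T'.RowsOK ∧ T'.A = T.A ∧ T'.ω = T.ω ∧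
      T'.rep m = T'.rep n ∧ (∀ j, T'.rep (T.rep j) = T'.rep j) ∧
      (∀ j, T.rep j = j → T'.rep j = j ∨ j ∈ Q') ∧ (∀ j, T.rep j ≠ j → T'.rep j ≠ j) ∧
      (∀ j ∈ Q, j ∈ Q') ∧ (∀ j ∈ Q', j ∈ Q ∨ T'.rep j ≠ j) ∧
      T'.live.card + Q'.length = T.live.card + Q.length := by
  by_cases hne : T.rep m = T.rep n
  · refine ⟨T, Q, by simp [merge, hne], hT, rfl, rfl, hne, rep_rep hT.ρ_le, fun j h => .inl h,
      fun j h => h, fun j h => h, fun j h => .inl h, rfl⟩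
  obtain ⟨a, b, hab, hma, hmb, ha, hb, hmn⟩ : ∃ a b, b < a ∧
      max (T.rep m) (T.rep n) = a ∧ min (T.rep m) (T.rep n) = b ∧ T.IsLive a ∧ T.IsLive b ∧
      ((T.rep m = a ∧ T.rep n = b) ∨ (T.rep m = b ∧ T.rep n = a)) := by
    have h1 := hT.isLive_rep hm.1 hm.2
    have h2 := hT.isLive_rep hn.1 hn.2
    rcases lt_or_gt_of_ne hne with h | h
    · exact ⟨_, _, h, max_eq_right h.le, min_eq_left h.le, h2, h1, .inr ⟨rfl, rfl⟩⟩
    · exact ⟨_, _, h, max_eq_left h.le, min_eq_right h.le, h1, h2, .inl ⟨rfl, rfl⟩⟩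
  -- All remaining claims are read off from this formula for the new representatives.
  have hrep : ∀ j, rep (Function.update T.ρ a b) j = if T.rep j = a then b else T.rep j :=
    rep_update_fixed hT.ρ_le ((rep_eq_self_iff hT.ρ_le a).1 ha.2.2)
      ((rep_eq_self_iff hT.ρ_le b).1 hb.2.2) hab
  have hok : Table.RowsOK { T with ρ := Function.update T.ρ a b } := by
    refine ⟨update_le hT.ρ_le hab.le, fun j hj => ?_, fun j hj => ?_⟩
    · have := hT.rep_pos j hj
      have := hb.1
      change 1 ≤ rep (Function.update T.ρ a b) j
      rw [hrep]
      split_ifs <;> assumption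
    · change rep (Function.update T.ρ a b) j = j
      have h := hT.rep_of_lt j hj
      have := ha.2.1
      change T.ω < j at hj
      rw [hrep, h, if_neg (by omega)]
  refine ⟨{ T with ρ := Function.update T.ρ a b }, Q ++ [a], ?_, hok, rfl, rfl, ?_, ?_, ?_, ?_, ?_,
    ?_, ?_⟩
  · have hne' : rep T.ρ m ≠ rep T.ρ n := hne
    simp only [merge, ne_eq, hne', not_false_eq_true, if_true]
    rw [← hma, ← hmb]
  · change rep (Function.update T.ρ a b) m = rep (Function.update T.ρ a b) n
    rw [hrep, hrep]
    rcases hmn with ⟨h1, h2⟩ | ⟨h1, h2⟩ <;> rw [h1, h2] <;> simp [hab.ne]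
  · intro j
    change rep (Function.update T.ρ a b) (T.rep j) = rep (Function.update T.ρ a b) j
    have h : T.rep (T.rep j) = T.rep j := rep_rep hT.ρ_le j
    rw [hrep, hrep, h]
  · intro j hj
    change rep (Function.update T.ρ a b) j = j ∨ _
    rw [hrep, hj]
    by_cases h : j = a <;> simp [h]
  · intro j hj
    change rep (Function.update T.ρ a b) j ≠ j
    rw [hrep]
    split_ifs with h
    · rintro rfl
      exact hj hb.2.2
    · exact hj
  · intro j hj
    simp [hj]
  · intro j hj
    rcases List.mem_append.1 hj with hj | hj
    · exact .inl hj
    · right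
      change rep (Function.update T.ρ a b) j ≠ j
      rw [List.mem_singleton.1 hj, hrep, ha.2.2, if_pos rfl]
      exact hab.ne
  · have hlive : Table.live { T with ρ := Function.update T.ρ a b } = T.live.erase a := by
      ext j
      rw [hok.mem_live, Finset.mem_erase, hT.mem_live]
      change (1 ≤ j ∧ j ≤ T.ω ∧ rep (Function.update T.ρ a b) j = j) ↔
        j ≠ a ∧ 1 ≤ j ∧ j ≤ T.ω ∧ T.rep j = j
      rw [hrep]
      constructor
      · rintro ⟨h1, h2, h3⟩
        split_ifs at h3 with h
        · subst h3
          exact absurd (hb.2.2.symm.trans h) hab.ne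
        · exact ⟨fun hj => h (h3.trans hj), h1, h2, h3⟩
      · rintro ⟨h1, h2, h3, h4⟩
        exact ⟨h2, h3, by rw [if_neg (by rwa [h4]), h4]⟩
    have hmem : a ∈ T.live := hT.mem_live.2 ha
    have := Finset.card_pos.2 ⟨a, hmem⟩
    rw [hlive, Finset.card_erase_of_mem hmem, List.length_append, List.length_singleton]
    omega

theorem mem_fix_of_inl {α β : Type} {f : α →. β ⊕ α} {a : α} {b : β} (h : Sum.inl b ∈ f a) :
    b ∈ f.fix a :=
  PFun.mem_fix_iff.2 (.inl h)

theorem mem_fix_of_inr {α β : Type} {f : α →. β ⊕ α} {a a' : α} {b : β} (h : Sum.inr a' ∈ f a)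
    (hb : b ∈ f.fix a') : b ∈ f.fix a :=
  PFun.mem_fix_iff.2 (.inr ⟨a', h, hb⟩)

/-! ### The procedure `Coincidence` -/

/-- The invariant of `Coincidence`: every entry is in a live row, in a row of the queue `Q`, or
pending in the sense of `P`. -/
structure Table.QueueInv (T : Table R) (Q : List ℕ) (P : ℕ → Letter g → Prop) : Prop where
  rows : T.RowsOK
  symm : T.Symm
  entry : ∀ ⦃r x s⦄, T.A r x = some s → 1 ≤ r ∧ r ≤ T.ω ∧ (T.rep r = r ∨ r ∈ Q ∨ P r x)
  queue : ∀ j ∈ Q, T.rep j ≠ j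

theorem Table.QueueInv.merge {T : Table R} {Q : List ℕ} {P : ℕ → Letter g → Prop}
    (h : T.QueueInv Q P) {m n : ℕ} (hm : 1 ≤ m ∧ m ≤ T.ω) (hn : 1 ≤ n ∧ n ≤ T.ω) :
    ∃ T' Q', RackEnum.merge (T, Q) m n = (T', Q') ∧ T'.QueueInv Q' P ∧ T'.A = T.A ∧ T'.ω = T.ω ∧
      T'.rep m = T'.rep n ∧ (∀ j, T'.rep (T.rep j) = T'.rep j) ∧
      (∀ j, T.rep j ≠ j → T'.rep j ≠ j) ∧
      T'.live.card + Q'.length = T.live.card + Q.length := by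
  obtain ⟨T', Q', heq, hrows, hA, hω, hmn, hrep, hlive, hdead, hQ, hQ', hcard⟩ :=
    merge_spec h.rows Q hm hn
  refine ⟨T', Q', heq, ⟨hrows, ?_, ?_, ?_⟩, hA, hω, hmn, hrep, hdead, hcard⟩
  · intro r x s hr
    rw [hA] at hr ⊢
    exact h.symm hr
  · intro r x s hr
    rw [hA] at hr
    obtain ⟨h1, h2, h3⟩ := h.entry hr
    rw [hω]
    refine ⟨h1, h2, ?_⟩
    rcases h3 with h3 | h3 | h3
    · rcases hlive r h3 with h4 | h4
      · exact .inl h4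
      · exact .inr (.inl h4)
    · exact .inr (.inl (hQ r h3))
    · exact .inr (.inr h3)
  · intro j hj
    rcases hQ' j hj with h4 | h4
    · exact hdead j (h.queue j h4)
    · exact h4

/-- The removed edge from `d` to `e` survives up to representatives. Either an edge already present
at `δ` or `ε` takes its place, its other end being merged with the missing one, or both places are
free and the edge is moved there. New entries are put only into live rows, so the dead row `d` is
never refilled and the pending letters shrink to `l`. -/
theorem coincidenceStep_spec {T : Table R} {Q : List ℕ} {d : ℕ} {x : Letter g}
    {l : List (Letter g)} (h : T.QueueInv Q fun r y => r = d ∧ y ∈ x :: l) (hd : T.rep d ≠ d) :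
    ∃ T' Q', coincidenceStep d (T, Q) x = (T', Q') ∧ T'.QueueInv Q' (fun r y => r = d ∧ y ∈ l) ∧
      T.Embeds T' ∧ T'.ω = T.ω ∧ T'.rep d ≠ d ∧
      T'.live.card + Q'.length = T.live.card + Q.length := by
  rcases hde : T.A d x with _ | e
  · refine ⟨T, Q, by simp [coincidenceStep, hde], ⟨h.rows, h.symm, ?_, h.queue⟩,
      h.rows.embeds_refl, rfl, hd, rfl⟩
    intro r y s hr
    obtain ⟨h1, h2, h3 | h3 | ⟨rfl, h3⟩⟩ := h.entry hr
    · exact ⟨h1, h2, .inl h3⟩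
    · exact ⟨h1, h2, .inr (.inl h3)⟩
    · rcases List.mem_cons.1 h3 with rfl | h3
      · simp [hde] at hr
      · exact ⟨h1, h2, .inr (.inr ⟨rfl, h3⟩)⟩
  have hed := h.symm hde
  obtain ⟨hd1, hd2, -⟩ := h.entry hde
  obtain ⟨he1, he2, -⟩ := h.entry hed
  set T₀ := (T.setEntry d x none).setEntry e x.bar none with hT₀
  set T₁ := T₀.update d with hT₁
  set T₂ := T₁.update e with hT₂
  have hle₀ : ∀ j, T₀.ρ j ≤ j := h.rows.ρ_le
  have hle₁ : ∀ j, T₁.ρ j ≤ j := Table.update_ρ_le hle₀ d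
  have hle₂ : ∀ j, T₂.ρ j ≤ j := Table.update_ρ_le hle₁ e
  have hrep₁ : ∀ j, T₁.rep j = T.rep j := Table.rep_update hle₀ d
  have hrep₂ : ∀ j, T₂.rep j = T.rep j := fun j => (Table.rep_update hle₁ e j).trans (hrep₁ j)
  have hA : ∀ r y, T₂.A r y =
      if (r = e ∧ y = x.bar) ∨ (r = d ∧ y = x) then none else T.A r y := by
    intro r y
    change (if r = e ∧ y = x.bar then none else if r = d ∧ y = x then none else T.A r y) = _
    by_cases h1 : r = e ∧ y = x.bar
    · rw [if_pos h1, if_pos (.inl h1)]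
    · rw [if_neg h1]
      by_cases h2 : r = d ∧ y = x
      · rw [if_pos h2, if_pos (.inr h2)]
      · rw [if_neg h2, if_neg (not_or.2 ⟨h1, h2⟩)]
  have hAsome : ∀ {r y s}, T₂.A r y = some s →
      ¬ (r = e ∧ y = x.bar) ∧ ¬ (r = d ∧ y = x) ∧ T.A r y = some s := by
    intro r y s hr
    rw [hA] at hr
    split_ifs at hr with hc
    rw [not_or] at hc
    exact ⟨hc.1, hc.2, hr⟩
  have hrows₂ : T₂.RowsOK :=
    ⟨hle₂, fun j hj => (hrep₂ j).symm ▸ h.rows.rep_pos j hj,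
      fun j hj => (hrep₂ j).trans (h.rows.rep_of_lt j hj)⟩
  have hsymm₂ : T₂.Symm := by
    intro r y s hr
    obtain ⟨h1, h2, h3⟩ := hAsome hr
    have h4 := h.symm h3
    rw [hA, if_neg, h4]
    rintro (⟨rfl, h5⟩ | ⟨rfl, h5⟩)
    · have : y = x := by rw [← Letter.bar_bar y, h5, Letter.bar_bar]
      subst this
      rw [hed] at h4
      exact h2 ⟨(Option.some.inj h4).symm, rfl⟩
    · rw [h5, hde] at h4
      exact h1 ⟨(Option.some.inj h4).symm, by rw [← h5, Letter.bar_bar]⟩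
  have hinv₂ : T₂.QueueInv Q (fun r y => r = d ∧ y ∈ l) := by
    refine ⟨hrows₂, hsymm₂, ?_, fun j hj => (hrep₂ j).symm ▸ h.queue j hj⟩
    intro r y s hr
    obtain ⟨-, h2, h3⟩ := hAsome hr
    obtain ⟨h4, h5, h6⟩ := h.entry h3
    refine ⟨h4, h5, ?_⟩
    rw [hrep₂]
    rcases h6 with h6 | h6 | ⟨rfl, h6⟩
    · exact .inl h6
    · exact .inr (.inl h6)
    · rcases List.mem_cons.1 h6 with rfl | h6
      · exact absurd ⟨rfl, rfl⟩ h2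
      · exact .inr (.inr ⟨rfl, h6⟩)
  have hcard₂ : T₂.live.card = T.live.card := by
    congr 1
    ext j
    rw [hrows₂.mem_live, h.rows.mem_live]
    change (1 ≤ j ∧ j ≤ T.ω ∧ T₂.rep j = j) ↔ (1 ≤ j ∧ j ≤ T.ω ∧ T.rep j = j)
    rw [hrep₂]
  have hd₂ : T₂.rep d ≠ d := by rwa [hrep₂]
  set δ := T.rep d with hδ
  set ε := T.rep e with hε
  have hδlive : T.IsLive δ := h.rows.isLive_rep hd1 hd2
  have hεlive : T.IsLive ε := h.rows.isLive_rep he1 he2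
  have hstep : coincidenceStep d (T, Q) x =
      match T₂.A δ x with
      | some f => merge (T₂, Q) ε f
      | none =>
        match T₂.A ε x.bar with
        | some f => merge (T₂, Q) δ f
        | none => (T₂.deduction δ x ε, Q) := by
    have hε' : T₁.rep e = ε := hrep₁ e
    simp only [coincidenceStep, hde]
    rw [← hε']
    rfl
  -- Only the edge from `d` to `e` and its reverse were undefined, so one substitute edge, together
  -- with its reverse, suffices in each of the three cases.
  have embed : ∀ T' : Table R, (∀ j, T'.rep (T.rep j) = T'.rep j) →
      (∀ r y s, T₂.A r y = some s → T'.A r y = some s) →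
      (∃ r' s', T'.A r' x = some s' ∧ T'.A s' x.bar = some r' ∧ T'.rep r' = T'.rep d ∧
        T'.rep s' = T'.rep e) → T.Embeds T' := by
    rintro T' h1 h2 ⟨r', s', h3, h4, h5, h6⟩
    refine ⟨h1, fun r y s hr => ?_⟩
    by_cases hc : (r = e ∧ y = x.bar) ∨ (r = d ∧ y = x)
    · rcases hc with ⟨rfl, rfl⟩ | ⟨rfl, rfl⟩
      · rw [hed] at hr
        cases hr
        exact ⟨s', r', h4, h6, h5⟩
      · rw [hde] at hr
        cases hr
        exact ⟨r', s', h3, h5, h6⟩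
    · exact ⟨r, s, h2 r y s (by rw [hA, if_neg hc, hr]), rfl, rfl⟩
  rw [hstep]
  rcases hf : T₂.A δ x with _ | f
  · rcases hf' : T₂.A ε x.bar with _ | f
    · have hded : ∀ r y, (T₂.deduction δ x ε).A r y =
          if r = ε ∧ y = x.bar then some δ else if r = δ ∧ y = x then some ε else T₂.A r y :=
        Table.deduction_A T₂ δ x ε
      have hrepd : ∀ j, (T₂.deduction δ x ε).rep j = T.rep j := hrep₂
      refine ⟨_, _, rfl, ⟨⟨hle₂, hrows₂.rep_pos, hrows₂.rep_of_lt⟩, ?_, ?_, hinv₂.queue⟩, ?_, rfl,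
        hd₂, by rw [← hcard₂]; rfl⟩
      · intro r y s hr
        rw [hded] at hr ⊢
        split_ifs at hr with h1 h2
        · cases hr
          obtain ⟨rfl, rfl⟩ := h1
          rw [Letter.bar_bar, if_neg (fun hc => Letter.bar_ne x hc.2.symm), if_pos ⟨rfl, rfl⟩]
        · cases hr
          obtain ⟨rfl, rfl⟩ := h2
          rw [if_pos ⟨rfl, rfl⟩]
        · have h3 := hsymm₂ hr
          rw [if_neg, if_neg, h3]
          · rintro ⟨rfl, h4⟩
            rw [h4, hf] at h3
            cases h3
          · rintro ⟨rfl, h4⟩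
            rw [h4, hf'] at h3
            cases h3
      · intro r y s hr
        rw [hded] at hr
        rw [hrepd]
        split_ifs at hr with h1 h2
        · rw [h1.1]
          exact ⟨hεlive.1, hεlive.2.1, .inl hεlive.2.2⟩
        · rw [h2.1]
          exact ⟨hδlive.1, hδlive.2.1, .inl hδlive.2.2⟩
        · have h3 := hinv₂.entry hr
          rwa [hrep₂] at h3
      · refine embed _ (fun j => ?_) (fun r y s hr => ?_)
          ⟨δ, ε, ?_, ?_, ?_, ?_⟩
        · rw [hrepd, hrepd]
          exact rep_rep h.rows.ρ_le j
        · rw [hded, if_neg, if_neg, hr]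
          · rintro ⟨rfl, rfl⟩
            rw [hf] at hr
            cases hr
          · rintro ⟨rfl, rfl⟩
            rw [hf'] at hr
            cases hr
        · rw [hded, if_neg (fun hc => Letter.bar_ne x hc.2.symm), if_pos ⟨rfl, rfl⟩]
        · rw [hded, if_pos ⟨rfl, rfl⟩]
        · rw [hrepd, hrepd, hδlive.2.2]
        · rw [hrepd, hrepd, hεlive.2.2]
    · have hfx := hsymm₂ hf'
      rw [Letter.bar_bar] at hfx
      have hfr := hinv₂.entry hfx
      obtain ⟨T', Q', heq, hinv, hA', hω', hmn, hrep', hdead, hcard⟩ :=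
        hinv₂.merge (m := δ) (n := f) ⟨hδlive.1, hδlive.2.1⟩ ⟨hfr.1, hfr.2.1⟩
      have hrep'' : ∀ j, T'.rep (T.rep j) = T'.rep j := fun j => by rw [← hrep₂, hrep']
      refine ⟨T', Q', heq, hinv, embed T' hrep'' (fun r y s hr => by rw [hA', hr])
        ⟨f, ε, by rw [hA', hfx], by rw [hA', hf'], ?_, hrep'' e⟩, hω', hdead d hd₂,
        by rw [hcard, hcard₂]⟩
      rw [← hmn, hδ, hrep'']
  · have hfx := hsymm₂ hf
    have hfr := hinv₂.entry hfx
    obtain ⟨T', Q', heq, hinv, hA', hω', hmn, hrep', hdead, hcard⟩ :=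
      hinv₂.merge (m := ε) (n := f) ⟨hεlive.1, hεlive.2.1⟩ ⟨hfr.1, hfr.2.1⟩
    have hrep'' : ∀ j, T'.rep (T.rep j) = T'.rep j := fun j => by rw [← hrep₂, hrep']
    refine ⟨T', Q', heq, hinv, embed T' hrep'' (fun r y s hr => by rw [hA', hr])
      ⟨δ, f, by rw [hA', hf], by rw [hA', hfx], hrep'' d, ?_⟩, hω', hdead d hd₂,
      by rw [hcard, hcard₂]⟩
    rw [← hmn, hε, hrep'']

theorem foldl_coincidenceStep_spec {d : ℕ} (l : List (Letter g)) {T : Table R} {Q : List ℕ}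
    (h : T.QueueInv Q fun r y => r = d ∧ y ∈ l) (hd : T.rep d ≠ d) :
    ∃ T' Q', l.foldl (coincidenceStep d) (T, Q) = (T', Q') ∧ T'.QueueInv Q' (fun _ _ => False) ∧
      T.Embeds T' ∧ T'.ω = T.ω ∧ T'.live.card + Q'.length = T.live.card + Q.length := by
  induction l generalizing T Q with
  | nil =>
    refine ⟨T, Q, rfl, ⟨h.rows, h.symm, fun r x s hr => ?_, h.queue⟩, h.rows.embeds_refl, rfl, rfl⟩
    simpa using h.entry hr
  | cons x l ih =>
    obtain ⟨T₁, Q₁, heq, hinv, hemb, hω, hd', hcard⟩ := coincidenceStep_spec h hd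
    obtain ⟨T', Q', heq', hinv', hemb', hω', hcard'⟩ := ih hinv hd'
    exact ⟨T', Q', by rw [List.foldl_cons, heq, heq'], hinv', hemb.trans hemb', hω'.trans hω,
      hcard'.trans hcard⟩

/-- Induction on live rows plus queue length: taking `d` off the queue lowers the sum by one, and
processing its row preserves it. An empty queue leaves entries in live rows only. -/
theorem coincidenceLoop_spec {order : List (Letter g)} (ho : ∀ y, y ∈ order) (N : ℕ) :
    ∀ {T : Table R} {Q : List ℕ}, T.live.card + Q.length = N → T.QueueInv Q (fun _ _ => False) →
      ∃ T' ∈ coincidenceLoop order (T, Q), T'.QueueInv [] (fun _ _ => False) ∧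
        T.Embeds T' ∧ T'.ω = T.ω := by
  induction N with
  | zero =>
    intro T Q hN h
    obtain rfl : Q = [] := List.length_eq_zero_iff.1 (by omega)
    refine ⟨T, ?_, h, h.rows.embeds_refl, rfl⟩
    exact mem_fix_of_inl (Part.mem_some _)
  | succ N ih =>
    intro T Q hN h
    rcases Q with _ | ⟨d, Q⟩
    · refine ⟨T, ?_, h, h.rows.embeds_refl, rfl⟩
      exact mem_fix_of_inl (Part.mem_some _)
    -- Row `d` changes from queued to pending; `order` contains all letters, so none of its entries
    -- escapes.
    have h₁ : T.QueueInv Q fun r y => r = d ∧ y ∈ order := by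
      refine ⟨h.rows, h.symm, fun r x s hr => ?_, fun j hj => h.queue j (List.mem_cons_of_mem _ hj)⟩
      obtain ⟨h1, h2, h3⟩ := h.entry hr
      refine ⟨h1, h2, ?_⟩
      simpa [ho, or_comm, or_left_comm] using h3
    obtain ⟨T₁, Q₁, heq, hinv, hemb, hω, hcard⟩ :=
      foldl_coincidenceStep_spec order h₁ (h.queue d List.mem_cons_self)
    rw [List.length_cons] at hN
    obtain ⟨T', hT', hinv', hemb', hω'⟩ := ih (by omega) hinv
    refine ⟨T', ?_, hinv', hemb.trans hemb', hω'.trans hω⟩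
    refine mem_fix_of_inr ?_ hT'
    rw [← heq]
    exact Part.mem_some _

/-! ### Consistent tables and their comparison -/

/-- `i ^ w = j` in the table `T`. -/
def Table.Path (T : Table R) : ℕ → List (Letter g) → ℕ → Prop
  | i, [], j => i = j
  | i, y :: w, j => ∃ k, T.A i y = some k ∧ T.Path k w j

/-- The entries of `T` form a partial involutive action on the live rows. -/
structure Table.Consistent (T : Table R) : Prop where
  rows : T.RowsOK
  symm : T.Symm
  live : ∀ ⦃r x s⦄, T.A r x = some s → T.IsLive r

/-- `T'` contains the quotient of `T` by the coincidences found between `T` and `T'`. -/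
structure Table.Le (T T' : Table R) : Prop where
  ω_le : T.ω ≤ T'.ω
  rep_rep : ∀ j, T'.rep (T.rep j) = T'.rep j
  edge : ∀ ⦃r x s⦄, T.A r x = some s → T'.A (T'.rep r) x = some (T'.rep s)

theorem Table.Consistent.live' {T : Table R} (h : T.Consistent) {r x s}
    (hr : T.A r x = some s) : T.IsLive s :=
  h.live (h.symm hr)

theorem Table.Consistent.le_refl {T : Table R} (h : T.Consistent) : T.Le T :=
  ⟨le_rfl, RackEnum.rep_rep h.rows.ρ_le, fun r x s hr => by
    rw [(h.live hr).2.2, (h.live' hr).2.2, hr]⟩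

theorem Table.Le.trans {T T' T'' : Table R} (h : T.Le T') (h' : T'.Le T'') : T.Le T'' where
  ω_le := h.ω_le.trans h'.ω_le
  rep_rep j := by rw [← h'.rep_rep, h.rep_rep, h'.rep_rep]
  edge r x s hr := by
    have := h'.edge (h.edge hr)
    rwa [h'.rep_rep, h'.rep_rep] at this

theorem Table.Le.path {T T' : Table R} (h : T.Le T') {i j : ℕ} {w : List (Letter g)}
    (hw : T.Path i w j) : T'.Path (T'.rep i) w (T'.rep j) := by
  induction w generalizing i with
  | nil => exact congrArg _ hw
  | cons y w ih =>
    obtain ⟨k, hk, hw⟩ := hw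
    exact ⟨_, h.edge hk, ih hw⟩

/-- Dead rows never revive. -/
theorem Table.Le.rep_eq_self {T T' : Table R} (h : T.Le T') {r : ℕ} (hr : T'.rep r = r) :
    T.rep r = r := by
  refine le_antisymm (rep_le _ _) ?_
  calc r = T'.rep (T.rep r) := by rw [h.rep_rep, hr]
    _ ≤ T.rep r := rep_le _ _

theorem Table.Path.append {T : Table R} {i j k : ℕ} {v w : List (Letter g)}
    (hv : T.Path i v j) (hw : T.Path j w k) : T.Path i (v ++ w) k := by
  induction v generalizing i with
  | nil => exact (show i = j from hv) ▸ hw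
  | cons y v ih =>
    obtain ⟨l, hl, hv⟩ := hv
    exact ⟨l, hl, ih hv⟩

theorem Table.Path.unique {T : Table R} {i j k : ℕ} {w : List (Letter g)}
    (h : T.Path i w j) (h' : T.Path i w k) : j = k := by
  induction w generalizing i with
  | nil => exact (show i = j from h).symm.trans h'
  | cons y w ih =>
    obtain ⟨l, hl, h⟩ := h
    obtain ⟨l', hl', h'⟩ := h'
    rw [hl] at hl'
    cases hl'
    exact ih h h'

theorem Table.Consistent.isLive_of_path {T : Table R} (h : T.Consistent) {i j : ℕ}
    {w : List (Letter g)} (hw : T.Path i w j) (hi : T.IsLive i) : T.IsLive j := by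
  induction w generalizing i with
  | nil => exact (show i = j from hw) ▸ hi
  | cons y w ih =>
    obtain ⟨k, hk, hw⟩ := hw
    exact ih hw (h.live' hk)

theorem Table.Consistent.path_reverse {T : Table R} (h : T.Consistent) {i j : ℕ}
    {w : List (Letter g)} (hw : T.Path i w j) : T.Path j (w.map Letter.bar).reverse i := by
  induction w generalizing i with
  | nil => exact (show i = j from hw).symm
  | cons y w ih =>
    obtain ⟨k, hk, hw⟩ := hw
    rw [List.map_cons, List.reverse_cons]
    exact (ih hw).append ⟨i, h.symm hk, rfl⟩

/-- A consistent table in which every row is reached from a generator. -/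
structure Table.Good (T : Table R) : Prop extends T.Consistent where
  g_le : g ≤ T.ω
  reach : ∀ r, 1 ≤ r → r ≤ T.ω → ∃ (i : Fin g) (w : List (Letter g)),
    T.Path (T.rep (i + 1)) w (T.rep r)

theorem Table.Good.of_le {T T' : Table R} (h : T.Good) (h' : T'.Consistent) (hle : T.Le T')
    (hω : T'.ω = T.ω) : T'.Good := by
  refine ⟨h', h.g_le.trans hle.ω_le, fun r h1 h2 => ?_⟩
  obtain ⟨i, w, hw⟩ := h.reach r h1 (hω ▸ h2)
  have := hle.path hw
  rw [hle.rep_rep, hle.rep_rep] at this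
  exact ⟨i, w, this⟩

theorem Table.Good.exists_coincidence {order : List (Letter g)} (ho : ∀ y, y ∈ order)
    {T : Table R} (h : T.Good) {m n : ℕ} (hm : T.IsLive m) (hn : T.IsLive n) :
    ∃ T' ∈ coincidence order T m n, T'.Good ∧ T.Le T' ∧ T'.rep m = T'.rep n := by
  have h₀ : T.QueueInv [] (fun _ _ => False) := by
    refine ⟨h.rows, h.symm, fun r x s hr => ?_, by simp⟩
    have := h.live hr
    exact ⟨this.1, this.2.1, .inl this.2.2⟩
  obtain ⟨T₁, Q, heq, hinv, hA, hω, hmn, hrep, -, -⟩ :=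
    h₀.merge ⟨hm.1, hm.2.1⟩ ⟨hn.1, hn.2.1⟩
  have hemb : T.Embeds T₁ := ⟨hrep, fun r x s hr => ⟨r, s, by rw [hA, hr], rfl, rfl⟩⟩
  obtain ⟨T', hT', hinv', hemb', hω'⟩ := coincidenceLoop_spec ho _ rfl hinv
  have hemb'' := hemb.trans hemb'
  have hcons : T'.Consistent := by
    refine ⟨hinv'.rows, hinv'.symm, fun r x s hr => ?_⟩
    have := hinv'.entry hr
    simpa [Table.IsLive] using this
  have hle : T.Le T' := by
    refine ⟨by rw [hω', hω], hemb''.rep_rep, fun r x s hr => ?_⟩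
    obtain ⟨r', s', hr', h1, h2⟩ := hemb''.edge hr
    -- All edges of the final table join live rows, which are their own representatives; so an
    -- embedding up to representatives becomes exact.
    rw [← h1, ← h2, (hcons.live hr').2.2, (hcons.live' hr').2.2, hr']
  refine ⟨T', ?_, h.of_le hcons hle (by rw [hω', hω]), hle, ?_⟩
  · rw [coincidence, heq]
    exact hT'
  · rw [← hemb'.rep_rep, hmn, hemb'.rep_rep]

/-! ### The procedures `Deduction`, `Define` and `Scan` -/

theorem Table.Consistent.deduction {T : Table R} (h : T.Consistent) {i j : ℕ} {y : Letter g}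
    (hi : T.IsLive i) (hj : T.IsLive j) (hiy : T.A i y = none) (hjy : T.A j y.bar = none) :
    (T.deduction i y j).Consistent ∧ T.Le (T.deduction i y j) ∧
      (T.deduction i y j).A i y = some j := by
  have hA := Table.deduction_A T i y j
  have hext : ∀ r x s, T.A r x = some s → (T.deduction i y j).A r x = some s := by
    intro r x s hr
    rw [hA, if_neg, if_neg, hr]
    · rintro ⟨rfl, rfl⟩
      rw [hiy] at hr
      cases hr
    · rintro ⟨rfl, rfl⟩
      rw [hjy] at hr
      cases hr
  have hij : (T.deduction i y j).A i y = some j := by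
    rw [hA, if_neg (fun hc => Letter.bar_ne y hc.2.symm), if_pos ⟨rfl, rfl⟩]
  have hji : (T.deduction i y j).A j y.bar = some i := by
    rw [hA, if_pos ⟨rfl, rfl⟩]
  refine ⟨⟨⟨h.rows.ρ_le, h.rows.rep_pos, h.rows.rep_of_lt⟩, ?_, ?_⟩, ⟨le_rfl, ?_, ?_⟩, hij⟩
  · intro r x s hr
    rw [hA] at hr
    split_ifs at hr with h1 h2
    · cases hr
      rw [h1.1, h1.2, Letter.bar_bar, hij]
    · cases hr
      rw [h2.1, h2.2, hji]
    · exact hext _ _ _ (h.symm hr)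
  · intro r x s hr
    rw [hA] at hr
    split_ifs at hr with h1 h2
    · rw [h1.1]
      exact hj
    · rw [h2.1]
      exact hi
    · exact h.live hr
  · exact RackEnum.rep_rep h.rows.ρ_le
  · intro r x s hr
    change (T.deduction i y j).A (T.rep r) x = some (T.rep s)
    rw [(h.live hr).2.2, (h.live' hr).2.2, hext r x s hr]

/-- The number `ω + 1` is already a fixed point of `ρ` with no entries, so adding the row changes no
representative, and the rest is a deduction at two free places. -/
theorem Table.Good.define {T : Table R} (h : T.Good) {i : ℕ} {y : Letter g} (hi : T.IsLive i)
    (hiy : T.A i y = none) :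
    (T.define i y).Good ∧ T.Le (T.define i y) ∧ (T.define i y).A i y = some (T.ω + 1) ∧
      ∀ j, (T.define i y).rep j = T.rep j := by
  have hn : T.rep (T.ω + 1) = T.ω + 1 := h.rows.rep_of_lt _ (Nat.lt_succ_self _)
  have hρ : Function.update T.ρ (T.ω + 1) (T.ω + 1) = T.ρ := by
    rw [Function.update_eq_self_iff]
    exact ((rep_eq_self_iff h.rows.ρ_le _).1 hn).symm
  set T₁ : Table R :=
    { ω := T.ω + 1
      A := T.A
      τ := Function.update T.τ (T.ω + 1) ((T.τ i).map fun p => p.pow y)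
      ρ := Function.update T.ρ (T.ω + 1) (T.ω + 1) } with hT₁
  have hrep₁ : ∀ j, T₁.rep j = T.rep j := fun j => congrArg (RackEnum.rep · j) hρ
  have hlive₁ : ∀ {r}, T.IsLive r → T₁.IsLive r := fun {r} hr =>
    ⟨hr.1, hr.2.1.trans (Nat.le_succ _), (hrep₁ r).trans hr.2.2⟩
  have hc₁ : T₁.Consistent := by
    refine ⟨⟨fun j => ?_, fun j hj => ?_, fun j hj => ?_⟩, h.symm, fun r x s hr =>
      hlive₁ (h.live hr)⟩
    · exact (congrFun hρ j).trans_le (h.rows.ρ_le j)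
    · rw [hrep₁]
      exact h.rows.rep_pos j hj
    · rw [hrep₁]
      exact h.rows.rep_of_lt j ((Nat.lt_succ_self _).trans hj)
  have hle₁ : T.Le T₁ := by
    refine ⟨Nat.le_succ _, fun j => ?_, fun r x s hr => ?_⟩
    · rw [hrep₁, hrep₁]
      exact RackEnum.rep_rep h.rows.ρ_le j
    · rw [hrep₁, hrep₁, (h.live hr).2.2, (h.live' hr).2.2]
      exact hr
  have hnone : T₁.A (T.ω + 1) y.bar = none := by
    rcases hs : T.A (T.ω + 1) y.bar with _ | s
    · rfl
    · have := (h.live hs).2.1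
      omega
  have hnlive : T₁.IsLive (T.ω + 1) := ⟨Nat.succ_pos _, le_rfl, (hrep₁ _).trans hn⟩
  obtain ⟨hc, hle, hA⟩ := hc₁.deduction (hlive₁ hi) hnlive hiy hnone
  have hle' : T.Le (T.define i y) := hle₁.trans hle
  have hrep : ∀ j, (T.define i y).rep j = T.rep j := hrep₁
  refine ⟨⟨hc, h.g_le.trans hle'.ω_le, fun r h1 h2 => ?_⟩, hle', hA, hrep⟩
  have hold : ∀ r, 1 ≤ r → r ≤ T.ω → ∃ (j : Fin g) (w : List (Letter g)),
      (T.define i y).Path ((T.define i y).rep (j + 1)) w ((T.define i y).rep r) := by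
    intro r h1 h2
    obtain ⟨j, w, hw⟩ := h.reach r h1 h2
    have := hle'.path hw
    rw [hle'.rep_rep, hle'.rep_rep] at this
    exact ⟨j, w, this⟩
  rcases Nat.lt_or_ge T.ω r with h3 | h3
  · obtain rfl : r = T.ω + 1 := le_antisymm h2 h3
    obtain ⟨j, w, hw⟩ := hold i hi.1 hi.2.1
    refine ⟨j, w ++ [y], hw.append ?_⟩
    rw [hrep, hrep, hi.2.2, hn]
    exact ⟨_, hA, rfl⟩
  · exact hold r h1 h3

theorem scanForward_spec (T : Table R) (k : ℕ) (v : List (Letter g)) :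
    ∃ u, v = u ++ (scanForward T k v).2 ∧ T.Path k u (scanForward T k v).1 ∧
      ∀ y v', (scanForward T k v).2 = y :: v' → T.A (scanForward T k v).1 y = none := by
  induction v generalizing k with
  | nil => exact ⟨[], rfl, rfl, by simp [scanForward]⟩
  | cons y v ih =>
    rcases hk : T.A k y with _ | k'
    · have : scanForward T k (y :: v) = (k, y :: v) := by simp [scanForward, hk]
      rw [this]
      refine ⟨[], rfl, rfl, fun z v' hz => ?_⟩
      cases hz
      exact hk
    · have : scanForward T k (y :: v) = scanForward T k' v := by simp [scanForward, hk]
      rw [this]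
      obtain ⟨u, hu, hp, hy⟩ := ih k'
      exact ⟨y :: u, congrArg (y :: ·) hu, ⟨k', hk, hp⟩, hy⟩

theorem scanForward_length_le (T : Table R) (k : ℕ) (v : List (Letter g)) :
    (scanForward T k v).2.length ≤ v.length := by
  obtain ⟨u, hu, -⟩ := scanForward_spec T k v
  conv_rhs => rw [hu, List.length_append]
  omega

theorem scanForward_cons_length {T : Table R} {k k' : ℕ} {y : Letter g} (h : T.A k y = some k')
    (v : List (Letter g)) : (scanForward T k (y :: v)).2.length ≤ v.length := by
  have : scanForward T k (y :: v) = scanForward T k' v := by simp [scanForward, h]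
  rw [this]
  exact scanForward_length_le T k' v

theorem map_bar_map_bar (v : List (Letter g)) : (v.map Letter.bar).map Letter.bar = v := by
  simp [List.map_map, Function.comp_def, Letter.bar_bar]

theorem scanBackward_spec {T : Table R} (hT : T.Consistent) (l : ℕ) (v : List (Letter g)) :
    ∃ u, v = (scanBackward T l v).2 ++ u ∧ T.Path (scanBackward T l v).1 u l ∧
      ∀ y v', (scanBackward T l v).2 = v' ++ [y] → T.A (scanBackward T l v).1 y.bar = none := by
  obtain ⟨u, hu, hp, hy⟩ := scanForward_spec T l (v.map Letter.bar).reverse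
  refine ⟨(u.map Letter.bar).reverse, ?_, hT.path_reverse hp, fun y v' hv => hy y.bar
    (v'.map Letter.bar).reverse ?_⟩
  · have := congrArg (fun w => (w.map Letter.bar).reverse) hu
    simp only [List.map_reverse, List.reverse_reverse, map_bar_map_bar, List.map_append,
      List.reverse_append] at this
    simpa [scanBackward, List.map_reverse] using this
  · have := congrArg (fun w => (w.map Letter.bar).reverse) hv
    simp only [scanBackward, List.map_reverse, List.reverse_reverse, map_bar_map_bar] at this
    rw [this]
    simp

/-- A scan terminates, and afterwards the scanned relation holds. -/
theorem scanLoop_spec {order : List (Letter g)} (ho : ∀ y, y ∈ order) (N : ℕ) :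
    ∀ {T : Table R} {k l : ℕ} {v : List (Letter g)},
      v.length + (scanForward T k v).2.length = N → T.Good → T.IsLive k → T.IsLive l →
      ∃ T' ∈ scanLoop order (T, k, l, v), T'.Good ∧ T.Le T' ∧
        ((v = [] → k = l) → T'.Path (T'.rep k) v (T'.rep l)) := by
  induction N using Nat.strong_induction_on with
  | _ N ih =>
  intro T k l v hN h hk hl
  by_cases hv : v = []
  · subst hv
    refine ⟨T, mem_fix_of_inl ?_, h, h.le_refl, fun hkl => congrArg T.rep (hkl rfl)⟩
    simp
  obtain ⟨u₁, hu₁, hp₁, hy₁⟩ := scanForward_spec T k v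
  rcases hf : scanForward T k v with ⟨k', v'⟩
  rw [hf] at hu₁ hp₁ hy₁ hN
  obtain ⟨u₂, hu₂, hp₂, hy₂⟩ := scanBackward_spec h.toConsistent l v'
  rcases hb : scanBackward T l v' with ⟨l', v''⟩
  rw [hb] at hu₂ hp₂ hy₂
  simp only at hu₁ hp₁ hy₁ hN hu₂ hp₂ hy₂
  have hk' : T.IsLive k' := h.isLive_of_path hp₁ hk
  have hl' : T.IsLive l' := by
    have := h.path_reverse hp₂
    exact h.isLive_of_path this hl
  have glue : ∀ T' : Table R, T.Le T' → T'.Path (T'.rep k') v'' (T'.rep l') →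
      T'.Path (T'.rep k) v (T'.rep l) := by
    intro T' hle hp
    rw [hu₁, hu₂]
    exact (hle.path hp₁).append (hp.append (hle.path hp₂))
  match v'', hu₂, hy₂, hb, glue with
  | [], hu₂, hy₂, hb, glue =>
    by_cases hkl : k' = l'
    · refine ⟨T, mem_fix_of_inl ?_, h, h.le_refl, fun _ => glue T h.le_refl (congrArg T.rep hkl)⟩
      simp [hv, hf, hb, hkl]
    · obtain ⟨T', hT', hg, hle, hkl'⟩ := h.exists_coincidence ho hk' hl'
      refine ⟨T', mem_fix_of_inr (a' := (T', k', l', [])) ?_ (mem_fix_of_inl ?_), hg, hle,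
        fun _ => glue T' hle hkl'⟩
      · simp only [hv, hf, hb, if_false]
        rw [if_pos hkl]
        exact Part.mem_map _ hT'
      · simp
  | [y], hu₂, hy₂, hb, glue =>
    obtain ⟨hc, hle, hA⟩ := h.deduction hk' hl' (hy₁ y u₂ (by rw [hu₂]; rfl)) (hy₂ y [] rfl)
    refine ⟨T.deduction k' y l', mem_fix_of_inl ?_, h.of_le hc hle rfl, hle, fun _ => glue _ hle ?_⟩
    · simp [hv, hf, hb]
    · exact ⟨l', by rw [← hA]; exact congrArg (fun j => (T.deduction k' y l').A j y) hk'.2.2,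
        hl'.2.2.symm⟩
  | y :: z :: v'', hu₂, hy₂, hb, glue =>
    have hky : T.A k' y = none := hy₁ y (z :: v'' ++ u₂) (by rw [hu₂]; rfl)
    obtain ⟨hg, hle, hA, hrep⟩ := h.define hk' hky
    have hlen₁ := congrArg List.length hu₁
    have hlen₂ := congrArg List.length hu₂
    -- The word itself need not get shorter in a turn that only defines a row, which is why the
    -- measure also counts what the next forward scan leaves over. That scan now passes `y`.
    have hlen₃ := scanForward_cons_length hA (z :: v'')
    simp only [List.length_append, List.length_cons] at hlen₁ hlen₂ hlen₃
    have hlive : ∀ {r}, T.IsLive r → (T.define k' y).IsLive r := fun {r} hr =>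
      ⟨hr.1, hr.2.1.trans hle.ω_le, (hrep r).trans hr.2.2⟩
    obtain ⟨T', hT', hg', hle', hp⟩ := ih _ (by simp only [List.length_cons]; omega)
      (T := T.define k' y) (k := k') (l := l') (v := y :: z :: v'') rfl hg (hlive hk') (hlive hl')
    refine ⟨T', mem_fix_of_inr (a' := (T.define k' y, k', l', y :: z :: v'')) ?_ hT', hg',
      hle.trans hle', fun _ => glue T' (hle.trans hle') (hp (by simp))⟩
    simp [hv, hf, hb]

theorem Table.Good.exists_scan {order : List (Letter g)} (ho : ∀ y, y ∈ order) {T : Table R}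
    (h : T.Good) {i j : ℕ} (hi : T.IsLive i) (hj : T.IsLive j) (w : List (Letter g)) :
    ∃ T' ∈ scan order T i w j, T'.Good ∧ T.Le T' ∧
      ((w = [] → i = j) → T'.Path (T'.rep i) w (T'.rep j)) :=
  scanLoop_spec ho _ rfl h hi hj

/-! ### The loops of `Enumerate` -/

theorem Table.init_good (R : Finset (Relation g)) : (Table.init R).Good := by
  have hrep : ∀ j, (Table.init R).rep j = j := fun j => rep_of_fixed rfl
  refine ⟨⟨⟨fun j => le_rfl, fun j hj => by rwa [hrep], fun j _ => hrep j⟩, ?_, ?_⟩, le_rfl, ?_⟩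
  · intro r x s hr
    cases hr
  · intro r x s hr
    cases hr
  · intro r h1 h2
    refine ⟨⟨r - 1, by change r ≤ g at h2; omega⟩, [], ?_⟩
    change (Table.init R).rep (r - 1 + 1) = (Table.init R).rep r
    rw [Nat.sub_add_cancel h1]

theorem Table.Good.isLive_gen {T : Table R} (h : T.Good) (i : Fin g) : T.IsLive (T.rep (i + 1)) :=
  h.rows.isLive_rep (Nat.succ_pos _) ((Nat.succ_le_of_lt i.2).trans h.g_le)

/-- The relation `r` holds in `T`. -/
def Table.Satisfies (T : Table R) (r : Relation g) : Prop :=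
  T.Path (T.rep (r.src + 1)) r.word.toWord (T.rep (r.tgt + 1))

theorem Table.Le.satisfies {T T' : Table R} (h : T.Le T') {r : Relation g} (hr : T.Satisfies r) :
    T'.Satisfies r := by
  have := h.path hr
  rwa [h.rep_rep, h.rep_rep] at this

theorem foldlM_scan_primary {order : List (Letter g)} (ho : ∀ y, y ∈ order)
    (l : List (Relation g)) (hl : ∀ r ∈ l, r.word = 1 → r.src = r.tgt) {T : Table R}
    (h : T.Good) :
    ∃ T' ∈ l.foldlM (m := Part) (fun T r => scan order T (RackEnum.rep T.ρ (r.src.val + 1))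
      r.word.toWord (RackEnum.rep T.ρ (r.tgt.val + 1))) T,
      T'.Good ∧ T.Le T' ∧ ∀ r ∈ l, T'.Satisfies r := by
  induction l generalizing T with
  | nil => exact ⟨T, Part.mem_some _, h, h.le_refl, by simp⟩
  | cons r l ih =>
    obtain ⟨T₁, hT₁, hg₁, hle₁, hp₁⟩ :=
      h.exists_scan ho (h.isLive_gen r.src) (h.isLive_gen r.tgt) r.word.toWord
    obtain ⟨T', hT', hg', hle', hp'⟩ := ih (fun r hr => hl r (List.mem_cons_of_mem _ hr)) hg₁
    refine ⟨T', ?_, hg', hle₁.trans hle', ?_⟩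
    · rw [List.foldlM_cons]
      exact Part.mem_bind hT₁ hT'
    · intro s hs
      rcases List.mem_cons.1 hs with rfl | hs
      · apply hle'.satisfies
        -- `Scan` does nothing for an empty word; this is where relations between distinct
        -- generators with empty word must be excluded.
        have := hp₁ fun hw => by
          rw [hl s List.mem_cons_self (FreeGroup.toWord_eq_nil_iff.1 hw)]
        rwa [hle₁.rep_rep, hle₁.rep_rep] at this
      · exact hp' s hs

/-- A row that is live at the end was live throughout, so no scan was skipped, and the relations
found earlier persist as paths from `i` to itself. -/
theorem foldlM_scan_secondary {order : List (Letter g)} (ho : ∀ y, y ∈ order)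
    (l : List (List (Letter g))) (i : ℕ) {T : Table R} (h : T.Good) :
    ∃ T' ∈ l.foldlM (m := Part)
      (fun T w => if i ∈ T.live then scan order T i w i else Part.some T) T,
      T'.Good ∧ T.Le T' ∧ (T'.IsLive i → T.IsLive i ∧ ∀ w ∈ l, T'.Path i w i) := by
  induction l generalizing T with
  | nil => exact ⟨T, Part.mem_some _, h, h.le_refl, fun hi => ⟨hi, by simp⟩⟩
  | cons w l ih =>
    obtain ⟨T₁, hT₁, hg₁, hle₁, hp₁⟩ : ∃ T₁ ∈ (if i ∈ T.live then scan order T i w i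
        else Part.some T), T₁.Good ∧ T.Le T₁ ∧ (T₁.IsLive i → T.IsLive i ∧ T₁.Path i w i) := by
      split_ifs with hi
      · have hi := h.rows.mem_live.1 hi
        obtain ⟨T₁, hT₁, hg₁, hle₁, hp₁⟩ := h.exists_scan ho hi hi w
        refine ⟨T₁, hT₁, hg₁, hle₁, fun hi' => ⟨hi, ?_⟩⟩
        have := hp₁ fun _ => rfl
        rwa [hi'.2.2] at this
      · exact ⟨T, Part.mem_some _, h, h.le_refl, fun hi' => absurd (h.rows.mem_live.2 hi') hi⟩
    obtain ⟨T', hT', hg', hle', hp'⟩ := ih hg₁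
    refine ⟨T', ?_, hg', hle₁.trans hle', fun hi => ?_⟩
    · rw [List.foldlM_cons]
      exact Part.mem_bind hT₁ hT'
    · obtain ⟨hi₁, hl⟩ := hp' hi
      obtain ⟨hi₀, hw⟩ := hp₁ hi₁
      refine ⟨hi₀, fun w' hw' => ?_⟩
      rcases List.mem_cons.1 hw' with rfl | hw'
      · have := hle'.path hw
        rwa [hi.2.2] at this
      · exact hl w' hw'

theorem foldl_define_spec (l : List (Letter g)) {i : ℕ} {T : Table R} (h : T.Good)
    (hi : T.IsLive i) :
    (l.foldl (fun T y => if (T.A i y).isNone then T.define i y else T) T).Good ∧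
      T.Le (l.foldl (fun T y => if (T.A i y).isNone then T.define i y else T) T) ∧
      (∀ j, (l.foldl (fun T y => if (T.A i y).isNone then T.define i y else T) T).rep j =
        T.rep j) ∧
      ∀ y ∈ l,
        ((l.foldl (fun T y => if (T.A i y).isNone then T.define i y else T) T).A i y).isSome := by
  induction l generalizing T with
  | nil => exact ⟨h, h.le_refl, fun _ => rfl, by simp⟩
  | cons y l ih =>
    rw [List.foldl_cons]
    obtain ⟨T₁, hT₁, hg₁, hle₁, hrep₁, hy⟩ : ∃ T₁,
        (if (T.A i y).isNone then T.define i y else T) = T₁ ∧ T₁.Good ∧ T.Le T₁ ∧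
          (∀ j, T₁.rep j = T.rep j) ∧ (T₁.A i y).isSome := by
      rcases hy : T.A i y with _ | s
      · obtain ⟨hg, hle, hA, hrep⟩ := h.define hi hy
        exact ⟨_, by simp, hg, hle, hrep, by simp [hA]⟩
      · exact ⟨T, by simp, h, h.le_refl, fun _ => rfl, by simp [hy]⟩
    rw [hT₁]
    obtain ⟨hg', hle', hrep', hl⟩ :=
      ih hg₁ ⟨hi.1, hi.2.1.trans hle₁.ω_le, (hrep₁ i).trans hi.2.2⟩
    refine ⟨hg', hle₁.trans hle', fun j => (hrep' j).trans (hrep₁ j), fun z hz => ?_⟩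
    rcases List.mem_cons.1 hz with rfl | hz
    · obtain ⟨s, hs⟩ := Option.isSome_iff_exists.1 hy
      have := hle'.edge hs
      rw [hrep', hrep₁, hi.2.2] at this
      rw [this]
      rfl
    · exact hl z hz

/-- One turn of the main loop of `Enumerate`. -/
theorem Table.Good.exists_step (o : LoopOrders R) {T : Table R} (h : T.Good) (i : ℕ) :
    ∃ T₁ ∈ scanSecondary o T i, (fillRow o T₁ i).Good ∧ T.Le (fillRow o T₁ i) ∧
      ((fillRow o T₁ i).IsLive i → (∀ y, ((fillRow o T₁ i).A i y).isSome) ∧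
        ∀ r ∈ R, (fillRow o T₁ i).Path i r.secondary i) := by
  obtain ⟨T₁, hT₁, hg₁, hle₁, hp₁⟩ := foldlM_scan_secondary o.mem_merge o.secondary i h
  refine ⟨T₁, hT₁, ?_⟩
  by_cases hi : i ∈ T₁.live
  · have hi' := hg₁.rows.mem_live.1 hi
    obtain ⟨hg, hle, hrep, hA⟩ := foldl_define_spec o.fill hg₁ hi'
    rw [fillRow, if_pos hi]
    refine ⟨hg, hle₁.trans hle, fun hi₂ => ⟨fun y => hA y (o.mem_fill y), fun r hr => ?_⟩⟩
    have := hle.path ((hp₁ hi').2 r.secondary ((o.mem_secondary _).2 ⟨r, hr, rfl⟩))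
    rwa [hi₂.2.2] at this
  · rw [fillRow, if_neg hi]
    exact ⟨hg₁, hle₁, fun hi' => absurd (hg₁.rows.mem_live.2 hi') hi⟩

/-! ### Racks from permutations that satisfy the relations -/

/-- If `F(S)` acts on `X` (on the right, through `u ↦ (φ u)⁻¹`), the points `p i` generate `X` and
satisfy the primary relations, and the secondary relations act trivially, then `X` is an image of
`⟨S | R⟩`. -/
theorem finite_of_perm [Finite (PresentedRack R)] {X : Type} (φ : FreeGroup (Fin g) →* Equiv.Perm X)
    (p : Fin g → X) (hp : ∀ r ∈ R, (φ r.word)⁻¹ (p r.src) = p r.tgt)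
    (hs : ∀ r ∈ R, φ (r.word⁻¹ * FreeGroup.of r.src * r.word * (FreeGroup.of r.tgt)⁻¹) = 1)
    (hgen : ∀ x, ∃ i u, (φ u)⁻¹ (p i) = x) : Finite X := by
  let f : FreeRack (Fin g) → X := fun a => (φ a.exp)⁻¹ (p a.gen)
  -- Up to inversion, `c a` is the permutation by which `a` operates. Since X carries no rack
  -- structure, the induction over the congruence must follow points and operators together: primary
  -- relations identify points, secondary relations identify operators.
  let c : FreeRack (Fin g) → Equiv.Perm X := fun a => φ (a.exp⁻¹ * FreeGroup.of a.gen * a.exp)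
  have hact : ∀ a b : FreeRack (Fin g), f (b ◃ a) = (c b)⁻¹ (f a) := by
    intro a b
    change (φ (a.exp * b.exp⁻¹ * FreeGroup.of b.gen * b.exp))⁻¹ (p a.gen) = _
    simp [f, c, mul_inv_rev, Equiv.Perm.mul_apply]
  have hinv : ∀ a b : FreeRack (Fin g), f (b ◃⁻¹ a) = c b (f a) := by
    intro a b
    change (φ (a.exp * b.exp⁻¹ * (FreeGroup.of b.gen)⁻¹ * b.exp))⁻¹ (p a.gen) = _
    simp [f, c, mul_inv_rev, Equiv.Perm.mul_apply]
  have hcact : ∀ a b : FreeRack (Fin g), c (b ◃ a) = (c b)⁻¹ * c a * c b := by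
    intro a b
    change φ ((a.exp * b.exp⁻¹ * FreeGroup.of b.gen * b.exp)⁻¹ * FreeGroup.of a.gen *
      (a.exp * b.exp⁻¹ * FreeGroup.of b.gen * b.exp)) = _
    simp [c, mul_inv_rev, mul_assoc]
  have hcinv : ∀ a b : FreeRack (Fin g), c (b ◃⁻¹ a) = c b * c a * (c b)⁻¹ := by
    intro a b
    change φ ((a.exp * b.exp⁻¹ * (FreeGroup.of b.gen)⁻¹ * b.exp)⁻¹ * FreeGroup.of a.gen *
      (a.exp * b.exp⁻¹ * (FreeGroup.of b.gen)⁻¹ * b.exp)) = _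
    simp [c, mul_inv_rev, mul_assoc]
  have key : ∀ a b, CongruenceClosure (relationPairs R) a b → f a = f b ∧ c a = c b := by
    intro a b h
    induction h with
    | of h =>
      obtain ⟨r, hr, h⟩ := h
      obtain ⟨rfl, rfl⟩ := Prod.mk.inj h
      refine ⟨?_, ?_⟩
      · change (φ r.word)⁻¹ (p r.src) = (φ 1)⁻¹ (p r.tgt)
        rw [hp r hr, map_one]
        rfl
      have := hs r hr
      rw [map_mul, map_inv, mul_inv_eq_one] at this
      simpa [c] using this
    | refl => exact ⟨rfl, rfl⟩
    | symm _ ih => exact ⟨ih.1.symm, ih.2.symm⟩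
    | trans _ _ ih ih' => exact ⟨ih.1.trans ih'.1, ih.2.trans ih'.2⟩
    | act _ _ ih ih' =>
      rw [hact, hact, hcact, hcact, ih.1, ih.2, ih'.2]
      exact ⟨rfl, rfl⟩
    | invAct _ _ ih ih' =>
      rw [hinv, hinv, hcinv, hcinv, ih.1, ih.2, ih'.2]
      exact ⟨rfl, rfl⟩
  let F : PresentedRack R → X := Quotient.lift f fun a b h => (key a b h).1
  refine Finite.of_surjective F fun x => ?_
  obtain ⟨i, u, h⟩ := hgen x
  exact ⟨Quotient.mk _ ⟨i, u⟩, h⟩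

/-! ### The limit of the tables -/

/-- An infinite run of `Enumerate`. -/
structure IsRun (T : ℕ → Table R) : Prop where
  good : ∀ n, (T n).Good
  le_succ : ∀ n, (T n).Le (T (n + 1))
  primary : ∀ r ∈ R, (T 0).Satisfies r
  row : ∀ n, (T (n + 1)).IsLive (n + 1) → (∀ y, ((T (n + 1)).A (n + 1) y).isSome) ∧
    ∀ r ∈ R, (T (n + 1)).Path (n + 1) r.secondary (n + 1)

theorem IsRun.le {T : ℕ → Table R} (h : IsRun T) {m n : ℕ} (hmn : m ≤ n) : (T m).Le (T n) := by
  induction n, hmn using Nat.le_induction with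
  | base => exact (h.good m).le_refl
  | succ n _ ih => exact ih.trans (h.le_succ n)

/-- A row live at stage `m` was live at its own turn `r`, provided that it existed then. Later
tables change the entries found at that turn only by passing to representatives, so a single `s`
serves all later stages. -/
theorem IsRun.row_filled {T : ℕ → Table R} (h : IsRun T) {r m : ℕ} (hr : 1 ≤ r) (hrm : r ≤ m)
    (hlive : (T m).rep r = r) (hω : r ≤ (T r).ω) :
    (∀ y, ∃ s, ∀ n, m ≤ n → (T n).rep r = r → (T n).A r y = some ((T n).rep s)) ∧
    ∀ q ∈ R, (T m).Path r q.secondary r := by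
  have hle := h.le hrm
  have hlive' : (T r).IsLive r := ⟨hr, hω, hle.rep_eq_self hlive⟩
  obtain ⟨r, rfl⟩ : ∃ k, r = k + 1 := ⟨r - 1, by omega⟩
  obtain ⟨h1, h2⟩ := h.row r hlive'
  refine ⟨fun y => ?_, fun q hq => ?_⟩
  · obtain ⟨s, hs⟩ := Option.isSome_iff_exists.1 (h1 y)
    refine ⟨s, fun n hn hrep => ?_⟩
    have := (h.le (hrm.trans hn)).edge hs
    rwa [hrep] at this
  · have := hle.path (h2 q hq)
    rwa [hlive] at this

theorem IsRun.exists_rep_limit {T : ℕ → Table R} (h : IsRun T) (j : ℕ) :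
    ∃ l, (∀ n, (T n).rep l = l) ∧ ∃ N, ∀ n, N ≤ n → (T n).rep j = l := by
  classical
  -- The limit is the least representative that `j` ever has.
  have hne : ∃ k, ∃ n, (T n).rep j = k := ⟨_, 0, rfl⟩
  obtain ⟨N, hN⟩ := Nat.find_spec hne
  have hlim : ∀ n, N ≤ n → (T n).rep j = Nat.find hne := by
    intro n hn
    refine le_antisymm ?_ (Nat.find_min' hne ⟨n, rfl⟩)
    rw [← (h.le hn).rep_rep, hN]
    exact rep_le _ _
  refine ⟨Nat.find hne, fun n => ?_, N, hlim⟩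
  rcases le_total N n with hn | hn
  · conv_lhs => rw [← hN]
    rw [(h.le hn).rep_rep, hlim n hn]
  · apply (h.le hn).rep_eq_self
    conv_lhs => rw [← hN]
    exact (RackEnum.rep_rep (h.good N).rows.ρ_le j).trans hN

/-- A run that never gets past its live rows forces `⟨S | R⟩` to be infinite. -/
theorem IsRun.exists_lt [Finite (PresentedRack R)] {T : ℕ → Table R} (h : IsRun T) :
    ∃ n, (T n).live.sup id < n + 1 := by
  by_contra! hcon
  have hω : ∀ r, 1 ≤ r → r ≤ (T r).ω := by
    intro r hr
    refine (Nat.le_succ r).trans ((hcon r).trans (Finset.sup_le fun i hi => ?_))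
    exact ((h.good r).rows.mem_live.1 hi).2.1
  -- The underlying set of the limit: the rows that never die.
  let X : Type := {r : ℕ // 1 ≤ r ∧ ∀ n, (T n).rep r = r}
  have hentry : ∀ (r : X) (y : Letter g), ∃ s : X, ∃ N, ∀ n, N ≤ n →
      (T n).A r.1 y = some s.1 := by
    intro ⟨r, hr, hrep⟩ y
    obtain ⟨s, hs⟩ := (h.row_filled hr le_rfl (hrep r) (hω r hr)).1 y
    obtain ⟨l, hl, N, hN⟩ := h.exists_rep_limit s
    have hA : ∀ n, max r N ≤ n → (T n).A r y = some l := by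
      intro n hn
      rw [hs n ((le_max_left _ _).trans hn) (hrep n), hN n ((le_max_right _ _).trans hn)]
    exact ⟨⟨l, ((h.good _).live' (hA _ le_rfl)).1, hl⟩, _, hA⟩
  choose act Nact hact using hentry
  have hbar : ∀ r y, act (act r y) y.bar = r := by
    intro r y
    have h1 := hact r y _ (le_max_left _ (Nact (act r y) y.bar))
    have h2 := hact (act r y) y.bar _ (le_max_right (Nact r y) _)
    have h3 := (h.good _).symm h1
    rw [h3] at h2
    exact Subtype.ext (Option.some.inj h2).symm
  have hbar' : ∀ r y, act (act r y.bar) y = r := by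
    intro r y
    have := hbar r y.bar
    rwa [Letter.bar_bar] at this
  have hpath : ∀ (w : List (Letter g)) (r : X), ∃ N, ∀ n, N ≤ n →
      (T n).Path r.1 w (w.foldl act r).1 := by
    intro w
    induction w with
    | nil => exact fun r => ⟨0, fun _ _ => rfl⟩
    | cons y w ih =>
      intro r
      obtain ⟨N, hN⟩ := ih (act r y)
      exact ⟨max (Nact r y) N, fun n hn => ⟨_, hact r y n ((le_max_left _ _).trans hn),
        hN n ((le_max_right _ _).trans hn)⟩⟩
  have hpath' : ∀ (w : List (Letter g)) (r s : X) (N : ℕ),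
      (∀ n, N ≤ n → (T n).Path r.1 w s.1) → w.foldl act r = s := by
    intro w r s N hN
    obtain ⟨N', hN'⟩ := hpath w r
    exact Subtype.ext ((hN' _ (le_max_right N N')).unique (hN _ (le_max_left N N')))
  let σ : Letter g → Equiv.Perm X := fun y =>
    ⟨fun r => act r y, fun r => act r y.bar, fun r => hbar r y, fun r => hbar' r y⟩
  -- Generators are sent to the action of their inverses, so that `u ↦ (φ u)⁻¹` is the right action
  -- that reads words from left to right.
  let φ : FreeGroup (Fin g) →* Equiv.Perm X := FreeGroup.lift fun i => σ (i, false)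
  have hσ : ∀ y : Letter g, φ (FreeGroup.mk [y]) = (σ y)⁻¹ := by
    rintro ⟨i, b⟩
    cases b
    · have : FreeGroup.mk [(i, false)] = (FreeGroup.of i)⁻¹ := rfl
      rw [this, map_inv, FreeGroup.lift_apply_of]
    · have : FreeGroup.mk [(i, true)] = FreeGroup.of i := rfl
      rw [this, FreeGroup.lift_apply_of]
      rfl
  have hφ : ∀ (w : List (Letter g)) (r : X), (φ (FreeGroup.mk w))⁻¹ r = w.foldl act r := by
    intro w
    induction w with
    | nil =>
      intro r
      have : FreeGroup.mk ([] : List (Letter g)) = 1 := rfl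
      rw [this, map_one]
      rfl
    | cons y w ih =>
      intro r
      have : FreeGroup.mk (y :: w) = FreeGroup.mk [y] * FreeGroup.mk w := rfl
      rw [this, map_mul, mul_inv_rev, Equiv.Perm.mul_apply, hσ, inv_inv, ih]
      rfl
  have hgens : ∀ i : Fin g, ∃ p : X, ∃ N, ∀ n, N ≤ n → (T n).rep (i + 1) = p.1 := by
    intro i
    obtain ⟨l, hl, N, hN⟩ := h.exists_rep_limit (i + 1)
    refine ⟨⟨l, ?_, hl⟩, N, hN⟩
    rw [← hN N le_rfl]
    exact ((h.good N).isLive_gen i).1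
  choose p Np hp using hgens
  have hX : Finite X := by
    refine finite_of_perm (R := R) φ p (fun r hr => ?_) (fun r hr => ?_) (fun x => ?_)
    · rw [← FreeGroup.mk_toWord (x := r.word), hφ]
      refine hpath' _ _ _ (max (Np r.src) (Np r.tgt)) fun n hn => ?_
      rw [← hp _ n ((le_max_left _ _).trans hn), ← hp _ n ((le_max_right _ _).trans hn)]
      exact (h.le (Nat.zero_le n)).satisfies (h.primary r hr)
    · rw [← inv_eq_one, ← FreeGroup.mk_toWord (x := r.word⁻¹ * _ * _ * _)]
      ext x : 1
      rw [hφ]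
      refine hpath' _ _ _ x.1 fun n hn => ?_
      exact (h.row_filled x.2.1 hn (x.2.2 n) (hω _ x.2.1)).2 r hr
    · obtain ⟨i, w, hw⟩ := (h.good x.1).reach x.1 x.2.1 (hω _ x.2.1)
      refine ⟨i, FreeGroup.mk w, ?_⟩
      rw [hφ]
      refine hpath' _ _ _ (max x.1 (Np i)) fun n hn => ?_
      have hle := h.le ((le_max_left _ _).trans hn)
      have := hle.path hw
      rwa [hle.rep_rep, hle.rep_rep, x.2.2, hp _ n ((le_max_right _ _).trans hn)] at this
  have := Fintype.ofFinite X
  -- Finiteness of X makes the stage at which entries become final uniform.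
  obtain ⟨N, hN⟩ : ∃ N, ∀ n, N ≤ n → (∀ r y, (T n).A (r : X).1 y = some (act r y).1) ∧
      ∀ i : Fin g, (T n).rep (i + 1) = (p i).1 := by
    refine ⟨max (Finset.univ.sup fun q : X × Letter g => Nact q.1 q.2) (Finset.univ.sup Np),
      fun n hn => ⟨fun r y => hact r y n ?_, fun i => hp i n ?_⟩⟩
    · exact (Finset.le_sup (f := fun q : X × Letter g => Nact q.1 q.2)
        (Finset.mem_univ (r, y))).trans ((le_max_left _ _).trans hn)
    · exact (Finset.le_sup (Finset.mem_univ i)).trans ((le_max_right _ _).trans hn)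
  have hstay : ∀ n, N ≤ n → ∀ (w : List (Letter g)) (r : X) (s : ℕ), (T n).Path r.1 w s →
      ∃ x : X, x.1 = s := by
    intro n hn w
    induction w with
    | nil => exact fun r s hs => ⟨r, hs⟩
    | cons y w ih =>
      rintro r s ⟨k, hk, hw⟩
      rw [(hN n hn).1] at hk
      cases hk
      exact ih _ _ hw
  let B : ℕ := Finset.univ.sup fun x : X => x.1
  have hbound : ∀ n, N ≤ n → (T n).live.sup id ≤ B := by
    intro n hn
    refine Finset.sup_le fun r hr => ?_
    have hr := (h.good n).rows.mem_live.1 hr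
    obtain ⟨i, w, hw⟩ := (h.good n).reach r hr.1 hr.2.1
    rw [hr.2.2, (hN n hn).2] at hw
    obtain ⟨x, rfl⟩ := hstay n hn w _ _ hw
    exact Finset.le_sup (f := fun x : X => x.1) (Finset.mem_univ x)
  have h1 := hbound (max N B) (le_max_left _ _)
  have h2 := hcon (max N B)
  have h3 := le_max_right N B
  omega

/-! ### The procedure `Enumerate` -/

theorem enumerateLoop_eq {o : LoopOrders R} {M : ℕ} {T T₁ : Table R} {i : ℕ}
    (h : i ≤ T.live.sup id ∧ i ≤ M) (hT₁ : T₁ ∈ scanSecondary o T i) {s : Table R × ℕ}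
    (hs : s ∈ enumerateLoop o M (fillRow o T₁ i, i + 1)) : s ∈ enumerateLoop o M (T, i) := by
  refine mem_fix_of_inr (a' := (fillRow o T₁ i, i + 1)) ?_ hs
  rw [if_pos h]
  exact Part.mem_map (fun T => Sum.inr (fillRow o T i, i + 1)) hT₁

theorem exists_completes (o : LoopOrders R) (hR : ∀ r ∈ R, r.word = 1 → r.src = r.tgt)
    [Finite (PresentedRack R)] : ∃ M, Completes o M := by
  obtain ⟨T₀, hT₀, hg₀, -, hp₀⟩ := foldlM_scan_primary o.mem_merge o.primary
    (fun r hr => hR r ((o.mem_primary r).1 hr)) (Table.init_good R)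
  choose next hnext hgood hle hrow using
    fun (T : {T : Table R // T.Good}) (i : ℕ) => T.2.exists_step o i
  -- The run without limit and without stopping test: stage `n` is the table when the counter equals
  -- `n + 1`.
  let U : ℕ → {T : Table R // T.Good} := fun n =>
    Nat.rec ⟨T₀, hg₀⟩ (fun n T => ⟨fillRow o (next T (n + 1)) (n + 1), hgood T (n + 1)⟩) n
  let T : ℕ → Table R := fun n => (U n).1
  have hrun : IsRun T := by
    refine ⟨fun n => (U n).2, fun n => hle (U n) (n + 1), fun r hr => ?_, fun n =>
      hrow (U n) (n + 1)⟩
    exact hp₀ r ((o.mem_primary r).2 hr)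
  classical
  have hex := hrun.exists_lt
  set n := Nat.find hex with hn
  have hend : (T n).live.sup id < n + 1 := Nat.find_spec hex
  have hcont : ∀ k, k < n → k + 1 ≤ (T k).live.sup id := fun k hk =>
    not_lt.1 (Nat.find_min hex hk)
  -- The induction goes backwards from the final state, since membership in `PFun.fix` is passed
  -- from a state to its predecessor.
  have hloop : ∀ k, k ≤ n → (T n, n + 1) ∈ enumerateLoop o n (T (n - k), n - k + 1) := by
    intro k
    induction k with
    | zero =>
      intro _
      refine mem_fix_of_inl ?_
      rw [if_neg (fun hc => absurd hc.1 (not_le.2 hend))]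
      exact Part.mem_some _
    | succ k ih =>
      intro hk
      have h1 := ih (by omega)
      obtain ⟨m, hm⟩ : ∃ m, n - (k + 1) = m := ⟨_, rfl⟩
      have hm' : n - k = m + 1 := by omega
      rw [hm'] at h1
      rw [hm]
      exact enumerateLoop_eq ⟨hcont m (by omega), by omega⟩ (hnext (U m) (m + 1)) h1
  have hrunloop : (T n, n + 1) ∈ enumerateLoop o n (T₀, 1) := by
    have := hloop n le_rfl
    rwa [Nat.sub_self] at this
  -- The limit `n` is just enough: the last row processed is `n`, and the counter then exceeds all
  -- live rows. Every live row is thus at most `n` and has had its turn.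
  refine ⟨n, T n, ?_, fun r hr y => ?_⟩
  · refine Part.mem_bind hT₀ (Part.mem_bind hrunloop ?_)
    rw [if_pos hend]
    exact Part.mem_some _
  · have hlive := (hrun.good n).rows.mem_live.1 hr
    have hrn : r ≤ n := Nat.lt_succ_iff.1 ((Finset.le_sup (f := id) hr).trans_lt hend)
    have hω : r ≤ (T r).ω := by
      obtain ⟨k, rfl⟩ : ∃ k, r = k + 1 := ⟨r - 1, by have := hlive.1; omega⟩
      refine (hcont k hrn).trans ((Finset.sup_le fun i hi => ?_).trans (hrun.le_succ k).ω_le)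
      exact ((hrun.good k).rows.mem_live.1 hi).2.1
    obtain ⟨s, hs⟩ := (hrun.row_filled hlive.1 hrn hlive.2.2 hω).1 y
    rw [hs n le_rfl hlive.2.2]
    rfl

end RackEnum

theorem mainTheorem2 (g : ℕ) (R : Finset (RackEnum.Relation g))
    (hR : ∀ r ∈ R, r.word = 1 → r.src = r.tgt)
    (hfin : Finite (RackEnum.PresentedRack R)) (o : RackEnum.LoopOrders R) :
    ∃ M : ℕ, RackEnum.Completes o M :=
  RackEnum.exists_completes o hR
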